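/- **Theorem.** A finite set of points in the plane is in general position if no three of its points lie on a line. A pseudo-triangle is a simple polygon with exactly three vertices whose interior angle is less than $180^\circ$; an $\ell$-pseudo-triangle is a pseudo-triangle with $\ell$ vertices. A point set contains a convex $k$-gon (an $\ell$-pseudo-triangle) if some $k$ (some $\ell$) of its points are the vertices of a convex polygon (of a pseudo-triangle); the polygon is not required to be empty. For integers $k,\ell\ge 3$ let $F(k,\ell)$ be the smallest integer $n$ such that every set of at least $n$ points in the plane in general position contains a convex $k$-gon or an $\ell$-pseudo-triangle. Then (i) $F(k,5)=2k-3$ for every integer $k\ge 3$; (ii) $F(k,6)=3k-6$ for every integer $k\ge 3$ with $k\ne 4$, while $F(4,6)=5$. -/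

import Mathlib

/-- The Euclidean plane. -/
abbrev Plane : Type := EuclideanSpace ℝ (Fin 2)

/-- No three distinct points of `S` lie on a line. -/
def InGeneralPosition (S : Finset Plane) : Prop :=
  ∀ p ∈ S, ∀ q ∈ S, ∀ r ∈ S, p ≠ q → p ≠ r → q ≠ r → ¬ Collinear ℝ {p, q, r}

/-- `S` contains a convex `k`-gon: `k` points of `S` are in convex position, i.e. none of them
lies in the convex hull of the others. -/
def ContainsConvexGon (k : ℕ) (S : Finset Plane) : Prop :=
  ∃ T : Finset Plane, T ⊆ S ∧ T.card = k ∧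
    ConvexIndependent ℝ (fun x : T => (x : Plane))

/-- The two-dimensional cross product (determinant) of two plane vectors. -/
noncomputable def cross (u v : Plane) : ℝ := u 0 * v 1 - u 1 * v 0

/-- The angle in `[0, 2π)` by which the direction of `u` has to be rotated anticlockwise to reach
the direction of `v`: the argument of `⟪u, v⟫ + i · cross u v`, reduced modulo `2π`. -/
noncomputable def ccwAngle (u v : Plane) : ℝ :=
  toIcoMod Real.two_pi_pos 0 (Complex.arg ⟨inner ℝ u v, cross u v⟩)

namespace Polygon

variable {n : ℕ}

/-- A simple polygon: at least three vertices, pairwise distinct, and two different edges meet at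
most in a common endpoint. -/
def IsSimple (P : Polygon Plane n) : Prop :=
  3 ≤ n ∧ Function.Injective P.vertices ∧
    ∀ i j : Fin n, i ≠ j → P.edgeSet ℝ i ∩ P.edgeSet ℝ j ⊆
      {P i, P (finRotate n i)} ∩ {P j, P (finRotate n j)}

/-- The signed area of a closed polygon (shoelace formula). -/
noncomputable def signedArea (P : Polygon Plane n) : ℝ :=
  (∑ i, cross (P i) (P (finRotate n i))) / 2

/-- The vertices are listed in anticlockwise order. For a simple polygon this means that the signed
area is positive; the interior then lies to the left of every directed edge. -/
def IsAnticlockwise (P : Polygon Plane n) : Prop := 0 < P.signedArea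

/-- The interior angle, in `[0, 2π)`, at the vertex `P i` of an anticlockwise simple polygon: the
interior near `P i` is swept by turning the outgoing edge anticlockwise to the incoming one. -/
noncomputable def interiorAngle (P : Polygon Plane n) (i : Fin n) : ℝ :=
  ccwAngle (P (finRotate n i) - P i) (P ((finRotate n).symm i) - P i)

/-- An `n`-pseudo-triangle, given by its vertices in anticlockwise order: a simple polygon with
exactly three vertices whose interior angle is less than `π`. -/
def IsPseudoTriangle (P : Polygon Plane n) : Prop :=
  P.IsSimple ∧ P.IsAnticlockwise ∧ {i : Fin n | P.interiorAngle i < Real.pi}.ncard = 3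

end Polygon

/-- `S` contains an `ℓ`-pseudo-triangle, i.e. one whose `ℓ` vertices are points of `S`. -/
def ContainsPseudoTriangle (ℓ : ℕ) (S : Finset Plane) : Prop :=
  ∃ P : Polygon Plane ℓ, P.IsPseudoTriangle ∧ ∀ i, P i ∈ S

/-- The numbers `n` such that every set of at least `n` points in general position contains a
convex `k`-gon or an `ℓ`-pseudo-triangle. -/
def ForcingNumbers (k ℓ : ℕ) : Set ℕ :=
  {n | ∀ S : Finset Plane, InGeneralPosition S → n ≤ S.card →
    ContainsConvexGon k S ∨ ContainsPseudoTriangle ℓ S}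

/-- `F k ℓ` is the least `n` such that every set of at least `n` points in general position contains
a convex `k`-gon or an `ℓ`-pseudo-triangle. (The infimum in `ℕ` is `0` if there is no such `n`,
and is otherwise attained.) -/
noncomputable def F (k ℓ : ℕ) : ℕ := sInf (ForcingNumbers k ℓ)

/-! Upper bounds. Suppose every triangle spanned by `S` holds at most t further points. Cutting the
convex hull along chords shows that v hull vertices enclose at most t(v - 2) points, so |S| ≤ (t +
1)v - 2t (`card_inside_hull_le`, `exists_large_convexPosition`). Hence (t + 1)(k - 1) - 2t + 1
points give either k points in convex position or a triangle with t + 1 points inside; this number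
is 2k - 3 for t = 1 and 3k - 6 for t = 2. Two points inside a triangle give a 5-pseudo-triangle,
since their line cuts off one corner. Three points inside give a 6-pseudo-triangle, a star-shaped
hexagon found by looking at which interior point comes first in angular order around each corner.
Two points inside also give a convex quadrilateral, whence F(4,6) ≤ 5.

Lower bounds. Place k - 1 thin, nearly vertical columns on a parabola, with one point in each outer
column and 1 + |E| points in each inner one. A triangle can contain only further points of the
column of its middle vertex, hence at most |E| points (`card_insideTriangle_gridSet_le`). A convex
polygon takes at most one point from each column strictly between its extreme columns; bending the
columns slightly limits the extreme ones, so that it has at most k - 1 vertices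
(`IsConvexIndexSet.card_le`). One extra level gives 2k - 4 points, two give 3k - 7; two extra levels
need at least four columns, which is why k = 4 is exceptional.

To exclude pseudo-triangles from the grid, one shows that the hull of a pseudo-triangle with at most
six vertices is a triangle, so that all its other vertices lie inside
(`ContainsPseudoTriangle.exists_triangle`). This rests on the fact that all hull vertices of a
simple polygon turn the same way, a form of the turning theorem: the total angle under which the
polygon is seen from a point of its boundary, suitably corrected at that point, is constant along
the boundary (`angle_sum_eq_of_edge`). -/

/-! ### Orientation, collinearity and membership in triangles. -/

/-- Twice the signed area of the triangle `a b c`. -/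
noncomputable def orient (a b c : Plane) : ℝ := cross (b - a) (c - a)

theorem orient_eq (a b c : Plane) :
    orient a b c = (b 0 - a 0) * (c 1 - a 1) - (b 1 - a 1) * (c 0 - a 0) := by
  simp [orient, cross]

theorem orient_rotate (a b c : Plane) : orient b c a = orient a b c := by
  simp only [orient_eq]; ring

theorem orient_swap (a b c : Plane) : orient a c b = -orient a b c := by
  simp only [orient_eq]; ring

theorem orient_swap_left (a b c : Plane) : orient b a c = -orient a b c := by
  simp only [orient_eq]; ring

@[simp] theorem orient_self_left (a b : Plane) : orient a a b = 0 := by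
  simp only [orient_eq]; ring

@[simp] theorem orient_self_right (a b : Plane) : orient a b b = 0 := by
  simp only [orient_eq]; ring

@[simp] theorem orient_self_outer (a b : Plane) : orient a b a = 0 := by
  simp only [orient_eq]; ring

theorem Plane.ext_coord {p q : Plane} (h0 : p 0 = q 0) (h1 : p 1 = q 1) : p = q := by
  ext i; fin_cases i <;> assumption

theorem collinear_iff_orient_eq_zero (a b c : Plane) :
    Collinear ℝ {a, b, c} ↔ orient a b c = 0 := by
  rw [collinear_iff_of_mem (p₀ := a) (by simp)]
  constructor
  · rintro ⟨v, hv⟩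
    obtain ⟨r, hr⟩ := hv b (by simp)
    obtain ⟨s, hs⟩ := hv c (by simp)
    rw [orient_eq, hr, hs]
    simp; ring
  · intro h
    rw [orient_eq] at h
    by_cases hab : b = a
    · refine ⟨c - a, ?_⟩
      simp only [Set.mem_insert_iff, Set.mem_singleton_iff, forall_eq_or_imp, forall_eq]
      exact ⟨⟨0, by simp⟩, ⟨0, by simp [hab]⟩, ⟨1, by simp⟩⟩
    · refine ⟨b - a, ?_⟩
      simp only [Set.mem_insert_iff, Set.mem_singleton_iff, forall_eq_or_imp, forall_eq]
      refine ⟨⟨0, by simp⟩, ⟨1, by simp⟩, ?_⟩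
      by_cases h0 : b 0 - a 0 = 0
      · have h1 : b 1 - a 1 ≠ 0 := fun h1 =>
          hab (Plane.ext_coord (by linarith) (by linarith))
        have h2 : c 0 - a 0 = 0 := by
          rw [h0] at h
          have : (b 1 - a 1) * (c 0 - a 0) = 0 := by linarith
          exact (mul_eq_zero.1 this).resolve_left h1
        refine ⟨(c 1 - a 1) / (b 1 - a 1), Plane.ext_coord ?_ ?_⟩
        · simp [h0]; linarith
        · simp; field_simp; ring
      · refine ⟨(c 0 - a 0) / (b 0 - a 0), Plane.ext_coord ?_ ?_⟩
        · simp; field_simp; ring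
        · simp; field_simp; linarith

theorem InGeneralPosition.orient_ne_zero {S : Finset Plane} (hS : InGeneralPosition S)
    {a b c : Plane} (ha : a ∈ S) (hb : b ∈ S) (hc : c ∈ S) (hab : a ≠ b) (hac : a ≠ c)
    (hbc : b ≠ c) : orient a b c ≠ 0 := fun h =>
  hS a ha b hb c hc hab hac hbc ((collinear_iff_orient_eq_zero a b c).2 h)

theorem InGeneralPosition.mono {S T : Finset Plane} (hS : InGeneralPosition S) (h : T ⊆ S) :
    InGeneralPosition T := fun p hp q hq r hr =>
  hS p (h hp) q (h hq) r (h hr)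

/-- An affine functional which is nonnegative on a set is nonnegative on its convex hull. -/
theorem affine_nonneg_of_mem_convexHull {T : Set Plane} {x : Plane} (hx : x ∈ convexHull ℝ T)
    (u v w : ℝ) (h : ∀ z ∈ T, 0 ≤ u * z 0 + v * z 1 + w) : 0 ≤ u * x 0 + v * x 1 + w := by
  have hc : Convex ℝ {z : Plane | 0 ≤ u * z 0 + v * z 1 + w} := by
    intro p hp q hq s t hs ht hst
    simp only [Set.mem_ofPred_eq, PiLp.add_apply, PiLp.smul_apply, smul_eq_mul] at *
    have : s * (u * p 0 + v * p 1 + w) + t * (u * q 0 + v * q 1 + w) =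
        u * (s * p 0 + t * q 0) + v * (s * p 1 + t * q 1) + w := by
      linear_combination w * hst
    rw [← this]; positivity
  exact convexHull_min h hc hx

theorem affine_pos_of_mem_convexHull {T : Set Plane} {x : Plane} (hx : x ∈ convexHull ℝ T)
    (u v w : ℝ) (h : ∀ z ∈ T, 0 < u * z 0 + v * z 1 + w) : 0 < u * x 0 + v * x 1 + w := by
  have hc : Convex ℝ {z : Plane | 0 < u * z 0 + v * z 1 + w} := by
    intro p hp q hq s t hs ht hst
    simp only [Set.mem_ofPred_eq, PiLp.add_apply, PiLp.smul_apply, smul_eq_mul] at *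
    have : s * (u * p 0 + v * p 1 + w) + t * (u * q 0 + v * q 1 + w) =
        u * (s * p 0 + t * q 0) + v * (s * p 1 + t * q 1) + w := by
      linear_combination w * hst
    rw [← this]
    rcases hs.eq_or_lt with rfl | hs
    · have : t = 1 := by linarith
      subst this; simpa using hq
    · positivity
  exact convexHull_min h hc hx

theorem orient_eq_affine (p q z : Plane) :
    orient p q z = -(q 1 - p 1) * z 0 + (q 0 - p 0) * z 1 +
      ((q 1 - p 1) * p 0 - (q 0 - p 0) * p 1) := by
  rw [orient_eq]; ring

theorem orient_nonneg_of_mem_convexHull {T : Set Plane} {p q x : Plane}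
    (hx : x ∈ convexHull ℝ T) (h : ∀ z ∈ T, 0 ≤ orient p q z) : 0 ≤ orient p q x := by
  simp only [orient_eq_affine p q] at *
  exact affine_nonneg_of_mem_convexHull hx _ _ _ h

theorem mem_convexHull_triple {a b c x : Plane} (hx : x ∈ convexHull ℝ {a, b, c}) :
    ∃ r s t : ℝ, 0 ≤ r ∧ 0 ≤ s ∧ 0 ≤ t ∧ r + s + t = 1 ∧ x = r • a + s • b + t • c := by
  rw [convexHull_insert (by simp), convexHull_pair] at hx
  simp only [convexJoin_singleton_left, Set.mem_iUnion] at hx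
  obtain ⟨y, ⟨s, t, hs, ht, hst, rfl⟩, u, v, hu, hv, huv, rfl⟩ := hx
  refine ⟨u, v * s, v * t, hu, by positivity, by positivity, ?_, ?_⟩
  · linear_combination v * hst + huv
  · rw [smul_add, smul_smul, smul_smul, add_assoc]

/-- A point of a triangle lying on a line through the vertex `a` that has the other two vertices
strictly on one side is `a`. -/
theorem eq_vertex_of_mem_convexHull_triple {a b c p q x : Plane}
    (hx : x ∈ convexHull ℝ {a, b, c}) (hxp : orient p q x = 0) (ha : orient p q a = 0)
    (hb : 0 < orient p q b) (hc : 0 < orient p q c) : x = a := by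
  obtain ⟨r, s, t, hr, hs, ht, hrst, rfl⟩ := mem_convexHull_triple hx
  have key : orient p q (r • a + s • b + t • c) =
      r * orient p q a + s * orient p q b + t * orient p q c := by
    have hr' : r = 1 - s - t := by linarith
    subst hr'
    simp [orient_eq]; ring
  rw [key, ha] at hxp
  have hs0 : s = 0 := by
    by_contra h
    have := hs.lt_of_ne' h
    nlinarith [mul_pos this hb, mul_nonneg ht hc.le]
  have ht0 : t = 0 := by
    by_contra h
    have := ht.lt_of_ne' h
    nlinarith [mul_pos this hc, mul_nonneg hs hb.le]
  have hr1 : r = 1 := by linarith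
  simp [hs0, ht0, hr1]

theorem mem_convexHull_of_orient_pos {a b c x : Plane} (h1 : 0 < orient a b x)
    (h2 : 0 < orient b c x) (h3 : 0 < orient c a x) : x ∈ convexHull ℝ {a, b, c} := by
  have hsum : orient a b c = orient b c x + orient c a x + orient a b x := by
    simp only [orient_eq]; ring
  have hpos : 0 < orient a b c := by linarith
  -- The barycentric coordinates are the area ratios of the three subtriangles at `x`.
  have hx : x = (orient b c x / orient a b c) • a + ((orient c a x / orient a b c) • b +
      (orient a b x / orient a b c) • c) := by
    refine Plane.ext_coord ?_ ?_ <;>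
    · simp only [PiLp.add_apply, PiLp.smul_apply, smul_eq_mul]
      field_simp
      simp only [orient_eq]; ring
  rw [hx]
  have hc := convex_convexHull ℝ ({a, b, c} : Set Plane)
  have := hc.sum_mem (t := Finset.univ) (w := ![orient b c x / orient a b c,
    orient c a x / orient a b c, orient a b x / orient a b c]) (z := ![a, b, c])
    (by intro i _; fin_cases i <;> simp <;> positivity)
    (by simp [Fin.sum_univ_three]; field_simp; linarith)
    (by intro i _; fin_cases i <;> exact subset_convexHull ℝ _ (by simp))
  simpa [Fin.sum_univ_three, add_assoc] using this

/-- In general position, a point of a triangle other than a vertex lies strictly inside. -/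
theorem orient_pos_of_mem_convexHull {a b c x : Plane} (habc : 0 < orient a b c)
    (hx : x ∈ convexHull ℝ {a, b, c}) (h1 : orient a b x ≠ 0) : 0 < orient a b x := by
  refine lt_of_le_of_ne (orient_nonneg_of_mem_convexHull hx ?_) h1.symm
  simp [habc.le]

/-! ### Counting points inside the hull of a set in convex position. -/

/-- The points of `S` in the triangle `a b c` other than its vertices. -/
noncomputable def insideTriangle (S : Finset Plane) (a b c : Plane) : Finset Plane := by
  classical
  exact S.filter fun x => x ∈ convexHull ℝ {a, b, c} ∧ x ≠ a ∧ x ≠ b ∧ x ≠ c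

theorem mem_insideTriangle {S : Finset Plane} {a b c x : Plane} :
    x ∈ insideTriangle S a b c ↔
      x ∈ S ∧ x ∈ convexHull ℝ {a, b, c} ∧ x ≠ a ∧ x ≠ b ∧ x ≠ c := by
  simp [insideTriangle]

/-- The points of `V` are in convex position: none is in the convex hull of the others. -/
abbrev ConvexPosition (V : Set Plane) : Prop := ConvexIndependent ℝ (Subtype.val : V → Plane)

/-- Krein–Milman; no closure is needed because there are only finitely many extreme points, so their
hull is compact. -/
theorem Set.Finite.subset_convexHull_extremePoints {W : Set Plane} (hW : W.Finite) :
    W ⊆ convexHull ℝ ((convexHull ℝ W).extremePoints ℝ) := by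
  have h := closure_convexHull_extremePoints (hW.isCompact_convexHull ℝ) (convex_convexHull ℝ W)
  have hfin : ((convexHull ℝ W).extremePoints ℝ).Finite :=
    hW.subset extremePoints_convexHull_subset
  rw [(hfin.isCompact_convexHull ℝ).isClosed.closure_eq] at h
  rw [h]
  exact subset_convexHull ℝ _

/-- Otherwise every extreme point would lie in `V \ {x}`, whose hull would then contain `x`. -/
theorem ConvexPosition.mem_extremePoints {V : Set Plane} (hV : ConvexPosition V) (hfin : V.Finite)
    {x : Plane} (hx : x ∈ V) : x ∈ (convexHull ℝ V).extremePoints ℝ := by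
  by_contra hne
  refine convexIndependent_set_iff_notMem_convexHull_sdiff.1 hV x hx
    (convexHull_mono ?_ (hfin.subset_convexHull_extremePoints hx))
  intro v hv
  exact ⟨extremePoints_convexHull_subset hv, fun h => hne (h ▸ hv)⟩

theorem exists_convexPosition_hull (W : Finset Plane) :
    ∃ V ⊆ W, ConvexPosition (V : Set Plane) ∧
      (W : Set Plane) ⊆ convexHull ℝ (V : Set Plane) ∧
      ∀ v ∈ V, v ∉ convexHull ℝ ((W : Set Plane) \ {v}) := by
  classical
  have hsub : (convexHull ℝ (W : Set Plane)).extremePoints ℝ ⊆ W :=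
    extremePoints_convexHull_subset
  have hV : ((W.filter fun x => x ∈ (convexHull ℝ (W : Set Plane)).extremePoints ℝ :
      Finset Plane) : Set Plane) = (convexHull ℝ (W : Set Plane)).extremePoints ℝ := by
    ext x
    simp only [Finset.coe_filter, Set.mem_ofPred_eq]
    exact ⟨fun h => h.2, fun h => ⟨hsub h, h⟩⟩
  refine ⟨W.filter fun x => x ∈ (convexHull ℝ (W : Set Plane)).extremePoints ℝ,
    Finset.filter_subset _ W, ?_, ?_, ?_⟩
  · rw [hV]
    exact (convex_convexHull ℝ _).convexIndependent_extremePoints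
  · rw [hV]
    exact W.finite_toSet.subset_convexHull_extremePoints
  · intro v hv
    have hv' := (Finset.mem_filter.1 hv).2
    rw [(convex_convexHull ℝ _).mem_extremePoints_iff_mem_sdiff_convexHull_sdiff] at hv'
    exact fun h => hv'.2 (convexHull_mono (Set.sdiff_subset_sdiff_left (subset_convexHull ℝ _)) h)

theorem orient_lineMap (x y p q : Plane) (r : ℝ) :
    orient x y (AffineMap.lineMap p q r) = (1 - r) * orient x y p + r * orient x y q := by
  simp only [orient_eq, AffineMap.lineMap_apply, vsub_eq_sub, vadd_eq_add, PiLp.add_apply,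
    PiLp.smul_apply, PiLp.sub_apply, smul_eq_mul]
  ring

theorem exists_lineMap_of_orient_eq_zero {x y s : Plane} (hxy : x ≠ y) (h : orient x y s = 0) :
    ∃ r : ℝ, s = AffineMap.lineMap x y r := by
  have hc := (collinear_iff_orient_eq_zero x y s).2 h
  have hs : s ∈ line[ℝ, x, y] :=
    hc.mem_affineSpan_of_mem_of_ne (p₁ := x) (p₂ := y) (by simp) (by simp) (by simp) hxy
  obtain ⟨r, hr⟩ := mem_affineSpan_pair_iff_exists_lineMap_eq.1 hs
  exact ⟨r, hr.symm⟩

/-- The line through two points of a convexly independent set meets the hull in a segment. -/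
theorem mem_segment_of_orient_eq_zero {V : Set Plane}
    (hV : ConvexPosition V) (hfin : V.Finite) {x y s : Plane} (hx : x ∈ V) (hy : y ∈ V)
    (hxy : x ≠ y) (hs : s ∈ convexHull ℝ V) (h : orient x y s = 0) : s ∈ segment ℝ x y := by
  have hx' := hV.mem_extremePoints hfin hx
  have hy' := hV.mem_extremePoints hfin hy
  obtain ⟨r, rfl⟩ := exists_lineMap_of_orient_eq_zero hxy h
  rw [segment_eq_image_lineMap]
  refine ⟨r, ⟨?_, ?_⟩, rfl⟩
  · by_contra! hr
    -- A negative parameter would put the extreme point `x` strictly between two points of the hull;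
    -- a parameter above 1 does the same to `y`.
    have hmem : x ∈ openSegment ℝ y (AffineMap.lineMap x y r) := by
      refine ⟨-r / (1 - r), 1 / (1 - r), div_pos (by linarith) (by linarith),
        div_pos one_pos (by linarith), ?_, ?_⟩
      · field_simp [show (1 - r : ℝ) ≠ 0 by linarith]; ring
      · have : (1 - r : ℝ) ≠ 0 := by linarith
        refine Plane.ext_coord ?_ ?_ <;>
        · simp [AffineMap.lineMap_apply]; field_simp; ring
    have := (mem_extremePoints_iff_left.1 hx').2 _ (subset_convexHull ℝ _ hy) _ hs hmem
    exact hxy this.symm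
  · by_contra! hr
    have hmem : y ∈ openSegment ℝ x (AffineMap.lineMap x y r) := by
      refine ⟨(r - 1) / r, 1 / r, div_pos (by linarith) (by linarith),
        div_pos one_pos (by linarith), ?_, ?_⟩
      · field_simp; ring
      · have : (r : ℝ) ≠ 0 := by linarith
        refine Plane.ext_coord ?_ ?_ <;>
        · simp [AffineMap.lineMap_apply]; field_simp; ring
    have := (mem_extremePoints_iff_left.1 hy').2 _ (subset_convexHull ℝ _ hx) _ hs hmem
    exact hxy this

/-- Cutting the hull of a convexly independent set along a chord. -/
theorem mem_convexHull_side {V : Set Plane}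
    (hV : ConvexPosition V) (hfin : V.Finite) {x y z : Plane} (hx : x ∈ V) (hy : y ∈ V)
    (hxy : x ≠ y) (hz : z ∈ convexHull ℝ V) (h : 0 < orient x y z) :
    z ∈ convexHull ℝ {v ∈ V | 0 ≤ orient x y v} := by
  set V₁ := {v ∈ V | 0 ≤ orient x y v} with hV₁
  set V₂ := {v ∈ V | orient x y v < 0} with hV₂
  have hun : V = V₁ ∪ V₂ := by
    ext v
    simp only [hV₁, hV₂, Set.mem_union, Set.mem_ofPred_eq]
    rcases le_or_gt 0 (orient x y v) with h | h <;> simp [h]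
  have hx1 : x ∈ V₁ := ⟨hx, by simp⟩
  have hy1 : y ∈ V₁ := ⟨hy, by simp⟩
  rcases V₂.eq_empty_or_nonempty with he | hne
  · rw [he, Set.union_empty] at hun
    rwa [← hun]
  · have hz' := hz
    rw [hun, convexHull_union ⟨x, hx1⟩ hne, mem_convexJoin] at hz'
    obtain ⟨q, hq, r, hr, hzqr⟩ := hz'
    rw [segment_eq_image_lineMap] at hzqr
    obtain ⟨t, ⟨ht0, ht1⟩, rfl⟩ := hzqr
    have hr0 : orient x y r < 0 := by
      have h1 := affine_pos_of_mem_convexHull hr (y 1 - x 1) (-(y 0 - x 0))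
        (-((y 1 - x 1) * x 0 - (y 0 - x 0) * x 1)) (fun v hv => by
          have := hv.2; rw [orient_eq_affine] at this; linarith)
      rw [orient_eq_affine]; linarith
    rw [orient_lineMap] at h
    have hq0 : 0 < orient x y q := by
      by_contra! hq0
      nlinarith
    -- At parameter `u` the segment from `q` to `r` crosses the line `x y`. The crossing point lies
    -- in the hull, hence on the segment `x y`, and `z` lies between it and `q`.
    set u := orient x y q / (orient x y q - orient x y r) with hu
    have hd : 0 < orient x y q - orient x y r := by linarith
    have hu0 : 0 < u := div_pos hq0 hd
    have hu1 : u < 1 := (div_lt_one hd).2 (by linarith)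
    have htu : t < u := by rw [hu, lt_div_iff₀ hd]; linarith
    set s : Plane := AffineMap.lineMap q r u with hs
    have hs0 : orient x y s = 0 := by
      rw [hs, orient_lineMap, hu]; field_simp; ring
    have hsV : s ∈ convexHull ℝ V := by
      refine (convex_convexHull ℝ V).segment_subset
        (convexHull_mono (fun v hv => hv.1) hq) (convexHull_mono (fun v hv => hv.1) hr) ?_
      rw [segment_eq_image_lineMap]
      exact ⟨u, ⟨hu0.le, hu1.le⟩, rfl⟩
    have hs1 : s ∈ convexHull ℝ V₁ :=
      (convex_convexHull ℝ V₁).segment_subset (subset_convexHull ℝ _ hx1)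
        (subset_convexHull ℝ _ hy1) (mem_segment_of_orient_eq_zero hV hfin hx hy hxy hsV hs0)
    refine (convex_convexHull ℝ V₁).segment_subset hq hs1 ?_
    rw [segment_eq_image_lineMap]
    refine ⟨t / u, ⟨by positivity, (div_le_one hu0).2 htu.le⟩, ?_⟩
    rw [hs]
    refine Plane.ext_coord ?_ ?_ <;>
    · simp [AffineMap.lineMap_apply]; field_simp

/-- A fourth point `w` is not in the triangle of three others, so some side of that triangle
separates `w` from the opposite vertex. -/
theorem exists_separating_chord {S V : Finset Plane} (hS : InGeneralPosition S) (hVS : V ⊆ S)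
    (hV : ConvexPosition (V : Set Plane)) (hcard : 4 ≤ V.card) :
    ∃ x ∈ V, ∃ y ∈ V, x ≠ y ∧ (∃ p ∈ V, 0 < orient x y p) ∧ ∃ q ∈ V, orient x y q < 0 := by
  classical
  obtain ⟨T, hT, hTc⟩ := Finset.exists_subset_card_eq (show 3 ≤ V.card by lia)
  obtain ⟨x, y, z, hxy, hxz, hyz, rfl⟩ := Finset.card_eq_three.1 hTc
  obtain ⟨w, hwV, hw⟩ := Finset.exists_mem_notMem_of_card_lt_card
    (lt_of_le_of_lt (Finset.card_le_three (a := x) (b := y) (c := z)) hcard)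
  simp only [Finset.mem_insert, Finset.mem_singleton, not_or] at hw
  have hx : x ∈ V := hT (by simp)
  have hy : y ∈ V := hT (by simp)
  have hz : z ∈ V := hT (by simp)
  have main : ∀ x ∈ V, ∀ y ∈ V, ∀ z ∈ V, x ≠ y → x ≠ z → y ≠ z → w ≠ x → w ≠ y → w ≠ z →
      0 < orient x y z →
      ∃ x ∈ V, ∃ y ∈ V, x ≠ y ∧ (∃ p ∈ V, 0 < orient x y p) ∧ ∃ q ∈ V, orient x y q < 0 := by
    intro x hx y hy z hz hxy hxz hyz hwx hwy hwz h
    have n1 := hS.orient_ne_zero (hVS hx) (hVS hy) (hVS hwV) hxy hwx.symm hwy.symm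
    have n2 := hS.orient_ne_zero (hVS hy) (hVS hz) (hVS hwV) hyz hwy.symm hwz.symm
    have n3 := hS.orient_ne_zero (hVS hz) (hVS hx) (hVS hwV) hxz.symm hwz.symm hwx.symm
    rcases n1.lt_or_gt with h1 | h1
    · exact ⟨x, hx, y, hy, hxy, ⟨z, hz, h⟩, w, hwV, h1⟩
    rcases n2.lt_or_gt with h2 | h2
    · exact ⟨y, hy, z, hz, hyz, ⟨x, hx, by rwa [orient_rotate]⟩, w, hwV, h2⟩
    rcases n3.lt_or_gt with h3 | h3
    · exact ⟨z, hz, x, hx, hxz.symm, ⟨y, hy, by rwa [← orient_rotate]⟩, w, hwV, h3⟩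
    refine absurd (mem_convexHull_of_orient_pos h1 h2 h3) fun hmem =>
      convexIndependent_set_iff_notMem_convexHull_sdiff.1 hV w hwV (convexHull_mono ?_ hmem)
    simp only [Set.insert_subset_iff, Set.singleton_subset_iff, Set.mem_sdiff,
      Finset.mem_coe, Set.mem_singleton_iff]
    exact ⟨⟨hx, hwx.symm⟩, ⟨hy, hwy.symm⟩, hz, hwz.symm⟩
  have n := hS.orient_ne_zero (hVS hx) (hVS hy) (hVS hz) hxy hxz hyz
  rcases n.lt_or_gt with h | h
  · exact main x hx z hz y hy hxz hxy hyz.symm hw.1 hw.2.2 hw.2.1 (by rw [orient_swap]; linarith)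
  · exact main x hx y hy z hz hxy hxz hyz hw.1 hw.2.1 hw.2.2 h

/-- Fan-type count: if every triangle contains at most `t` further points, then the hull of a convex
`n`-gon contains at most `t * (n - 2)` further points. -/
theorem card_inside_hull_le {S : Finset Plane} (hS : InGeneralPosition S) {t : ℕ}
    (ht : ∀ a ∈ S, ∀ b ∈ S, ∀ c ∈ S, a ≠ b → a ≠ c → b ≠ c → (insideTriangle S a b c).card ≤ t)
    (n : ℕ) : ∀ V ⊆ S, V.card = n → 3 ≤ n →
      ConvexPosition (V : Set Plane) → ∀ I ⊆ S,
      (∀ z ∈ I, z ∈ convexHull ℝ (V : Set Plane) ∧ z ∉ V) → I.card + 2 * t ≤ t * n := by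
  classical
  induction n using Nat.strong_induction_on with
  | _ n ih =>
    intro V hVS hVn hn hV I hIS hI
    rcases hn.eq_or_lt with rfl | hn4
    · obtain ⟨a, b, c, hab, hac, hbc, rfl⟩ := Finset.card_eq_three.1 hVn
      have hle : I ⊆ insideTriangle S a b c := by
        intro z hz
        obtain ⟨h1, h2⟩ := hI z hz
        simp only [Finset.mem_insert, Finset.mem_singleton, not_or] at h2
        exact mem_insideTriangle.2 ⟨hIS hz, by simpa using h1, h2⟩
      have := (Finset.card_le_card hle).trans
        (ht a (hVS (by simp)) b (hVS (by simp)) c (hVS (by simp)) hab hac hbc)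
      lia
    · obtain ⟨x, hx, y, hy, hxy, ⟨p, hp, hp0⟩, q, hq, hq0⟩ :=
        exists_separating_chord hS hVS hV (by lia)
      set V₁ := V.filter fun v => 0 ≤ orient x y v with hV₁
      set V₂ := V.filter fun v => orient x y v ≤ 0 with hV₂
      have s1 : V₁ ⊆ V := Finset.filter_subset _ _
      have s2 : V₂ ⊆ V := Finset.filter_subset _ _
      have hunion : V₁ ∪ V₂ = V := by
        ext v
        simp only [hV₁, hV₂, Finset.mem_union, Finset.mem_filter]
        rcases le_total 0 (orient x y v) with h | h <;> simp [h] <;> tauto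
      have hinter : V₁ ∩ V₂ = {x, y} := by
        ext v
        simp only [hV₁, hV₂, Finset.mem_inter, Finset.mem_filter, Finset.mem_insert,
          Finset.mem_singleton]
        constructor
        · rintro ⟨⟨hv, h1⟩, -, h2⟩
          by_contra! hne
          exact hS.orient_ne_zero (hVS hx) (hVS hy) (hVS hv) hxy hne.1.symm hne.2.symm
            (le_antisymm h2 h1)
        · rintro (rfl | rfl) <;> simp [hx, hy]
      -- Both parts keep the ends of the chord, so the sizes reduced by 2 add up to `n - 2` and the
      -- two bounds add up exactly.
      have hcard : V₁.card + V₂.card = n + 2 := by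
        rw [← Finset.card_union_add_card_inter, hunion, hinter, hVn, Finset.card_pair hxy]
      have c1 : V₁.card < n := by
        rw [← hVn]
        refine Finset.card_lt_card (Finset.ssubset_iff_of_subset s1 |>.2 ⟨q, hq, ?_⟩)
        simp [hV₁, hq0]
      have c2 : V₂.card < n := by
        rw [← hVn]
        refine Finset.card_lt_card (Finset.ssubset_iff_of_subset s2 |>.2 ⟨p, hp, ?_⟩)
        simp [hV₂, hp0]
      set I₁ := I.filter fun z => 0 < orient x y z with hI₁
      set I₂ := I.filter fun z => ¬ 0 < orient x y z with hI₂
      have hIc : I₁.card + I₂.card = I.card := Finset.card_filter_add_card_filter_not _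
      have e1 := ih V₁.card c1 V₁ (s1.trans hVS) rfl (by lia) (hV.mono (by exact_mod_cast s1)) I₁
        ((Finset.filter_subset _ _).trans hIS) (by
          intro z hz
          obtain ⟨hzI, hz0⟩ := Finset.mem_filter.1 hz
          refine ⟨?_, fun h => (hI z hzI).2 (s1 h)⟩
          have := mem_convexHull_side hV V.finite_toSet hx hy hxy (hI z hzI).1 hz0
          simpa [hV₁] using this)
      have e2 := ih V₂.card c2 V₂ (s2.trans hVS) rfl (by lia) (hV.mono (by exact_mod_cast s2)) I₂
        ((Finset.filter_subset _ _).trans hIS) (by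
          intro z hz
          obtain ⟨hzI, hz0⟩ := Finset.mem_filter.1 hz
          refine ⟨?_, fun h => (hI z hzI).2 (s2 h)⟩
          have hzV := (hI z hzI).2
          have hne := hS.orient_ne_zero (hVS hx) (hVS hy) (hIS hzI) hxy
            (fun h => hzV (h ▸ hx)) (fun h => hzV (h ▸ hy))
          have hlt : 0 < orient y x z := by
            rw [orient_swap_left]; have := lt_of_le_of_ne (not_lt.1 hz0) hne; linarith
          have := mem_convexHull_side hV V.finite_toSet hy hx hxy.symm (hI z hzI).1 hlt
          simpa [hV₂, orient_swap_left x y] using this)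
      have : t * V₁.card + t * V₂.card = t * n + 2 * t := by
        rw [← mul_add, hcard]; ring
      lia

theorem orient_eq_zero_of_mem_segment {x y a b c : Plane} (ha : a ∈ segment ℝ x y)
    (hb : b ∈ segment ℝ x y) (hc : c ∈ segment ℝ x y) : orient a b c = 0 := by
  rw [segment_eq_image_lineMap] at ha hb hc
  obtain ⟨r, -, rfl⟩ := ha
  obtain ⟨s, -, rfl⟩ := hb
  obtain ⟨t, -, rfl⟩ := hc
  simp [orient_eq, AffineMap.lineMap_apply]; ring

theorem three_le_card_of_subset_convexHull {S V : Finset Plane} (hS : InGeneralPosition S)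
    (hcard : 3 ≤ S.card) (h : (S : Set Plane) ⊆ convexHull ℝ (V : Set Plane)) : 3 ≤ V.card := by
  classical
  by_contra! hV
  obtain ⟨T, hT, hTc⟩ := Finset.exists_subset_card_eq hcard
  obtain ⟨a, b, c, hab, hac, hbc, rfl⟩ := Finset.card_eq_three.1 hTc
  have ha : a ∈ S := hT (by simp)
  have hb : b ∈ S := hT (by simp)
  have hc : c ∈ S := hT (by simp)
  obtain ⟨x, y, hxy⟩ : ∃ x y, V ⊆ {x, y} := by
    interval_cases hVc : V.card
    · exact ⟨a, a, by simp [Finset.card_eq_zero.1 hVc]⟩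
    · obtain ⟨x, rfl⟩ := Finset.card_eq_one.1 hVc
      exact ⟨x, x, by simp⟩
    · obtain ⟨x, y, -, rfl⟩ := Finset.card_eq_two.1 hVc
      exact ⟨x, y, subset_rfl⟩
  have hseg : ∀ z ∈ S, z ∈ segment ℝ x y := by
    intro z hz
    rw [← convexHull_pair]
    exact convexHull_mono (by simpa using Finset.coe_subset.2 hxy) (h hz)
  exact hS.orient_ne_zero ha hb hc hab hac hbc
    (orient_eq_zero_of_mem_segment (hseg a ha) (hseg b hb) (hseg c hc))

/-- With `V` the hull vertices, the remaining points number at most `t * (V.card - 2)`. -/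
theorem exists_large_convexPosition {S : Finset Plane} (hS : InGeneralPosition S)
    (hcard : 3 ≤ S.card) {t : ℕ}
    (ht : ∀ a ∈ S, ∀ b ∈ S, ∀ c ∈ S, a ≠ b → a ≠ c → b ≠ c →
      (insideTriangle S a b c).card ≤ t) :
    ∃ V ⊆ S, ConvexPosition (V : Set Plane) ∧
      S.card + 2 * t ≤ (t + 1) * V.card := by
  classical
  obtain ⟨V, hVS, hV, hSV, -⟩ := exists_convexPosition_hull S
  refine ⟨V, hVS, hV, ?_⟩
  have h3 := three_le_card_of_subset_convexHull hS hcard hSV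
  have := card_inside_hull_le hS ht V.card V hVS rfl h3 hV (S \ V) Finset.sdiff_subset (by
    intro z hz
    obtain ⟨h1, h2⟩ := Finset.mem_sdiff.1 hz
    exact ⟨hSV h1, h2⟩)
  have hc := Finset.card_sdiff_add_card_eq_card hVS
  have : (t + 1) * V.card = t * V.card + V.card := by ring
  lia

theorem containsConvexGon_of_convexPosition {S V : Finset Plane} {k : ℕ} (hVS : V ⊆ S)
    (hV : ConvexPosition (V : Set Plane)) (hk : k ≤ V.card) :
    ContainsConvexGon k S := by
  obtain ⟨T, hT, hTc⟩ := Finset.exists_subset_card_eq hk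
  exact ⟨T, hT.trans hVS, hTc, hV.mono (s := (T : Set Plane)) (by exact_mod_cast hT)⟩

/-! ### Pseudo-triangles from sign conditions on orientations. -/

/-- The argument has the sign of the cross product, and negative arguments are shifted by 2π to
above π. For parallel vectors of equal direction the angle is 0, so the cross product has to be
nonzero. -/
theorem ccwAngle_lt_pi_iff {u v : Plane} (h : cross u v ≠ 0) :
    ccwAngle u v < Real.pi ↔ 0 < cross u v := by
  unfold ccwAngle
  set z : ℂ := ⟨inner ℝ u v, cross u v⟩ with hz
  have hle := Complex.arg_le_pi z
  have hgt := Complex.neg_pi_lt_arg z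
  have hpi := Real.pi_pos
  rcases h.lt_or_gt with h | h
  · have harg : Complex.arg z < 0 := Complex.arg_neg_iff.2 h
    have : toIcoMod Real.two_pi_pos 0 (Complex.arg z) = Complex.arg z + 2 * Real.pi := by
      rw [← toIcoMod_add_right]
      exact (toIcoMod_eq_self _).2 ⟨by linarith, by linarith⟩
    rw [this]
    constructor <;> intro <;> linarith
  · have harg : 0 ≤ Complex.arg z := Complex.arg_nonneg_iff.2 h.le
    have hlt : Complex.arg z < Real.pi := Complex.arg_lt_pi_iff.2 (Or.inr h.ne')
    have : toIcoMod Real.two_pi_pos 0 (Complex.arg z) = Complex.arg z :=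
      (toIcoMod_eq_self _).2 ⟨by linarith, by linarith⟩
    rw [this]
    constructor <;> intro <;> linarith

theorem Polygon.interiorAngle_lt_pi_iff {n : ℕ} (P : Polygon Plane n) (i : Fin n)
    (h : orient (P ((finRotate n).symm i)) (P i) (P (finRotate n i)) ≠ 0) :
    P.interiorAngle i < Real.pi ↔
      0 < orient (P ((finRotate n).symm i)) (P i) (P (finRotate n i)) := by
  rw [← orient_rotate] at h ⊢
  exact ccwAngle_lt_pi_iff h

/-- The segments `p q` and `r s` are separated by the line through one of them. -/
def Separated (p q r s : Plane) : Prop :=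
  0 < orient p q r * orient p q s ∨ 0 < orient r s p * orient r s q

theorem orient_ne_zero_of_mem_affineSegment {p q r s x : Plane}
    (h : 0 < orient p q r * orient p q s) (hx : x ∈ affineSegment ℝ r s) :
    orient p q x ≠ 0 := by
  obtain ⟨t, ⟨ht0, ht1⟩, rfl⟩ := hx
  rw [orient_lineMap]
  rcases mul_pos_iff.1 h with ⟨h1, h2⟩ | ⟨h1, h2⟩
  · rcases ht0.eq_or_lt with rfl | ht0
    · simpa using h1.ne'
    · have := mul_nonneg (sub_nonneg.2 ht1) h1.le
      have := mul_pos ht0 h2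
      linarith
  · rcases ht0.eq_or_lt with rfl | ht0
    · simpa using h1.ne
    · have := mul_nonneg (sub_nonneg.2 ht1) (neg_nonneg.2 h1.le)
      have := mul_pos ht0 (neg_pos.2 h2)
      linarith

theorem orient_eq_zero_of_mem_affineSegment {p q x : Plane} (hx : x ∈ affineSegment ℝ p q) :
    orient p q x = 0 := by
  obtain ⟨t, -, rfl⟩ := hx
  simp [orient_lineMap]

theorem Separated.disjoint {p q r s x : Plane} (h : Separated p q r s)
    (hx : x ∈ affineSegment ℝ p q) (hx' : x ∈ affineSegment ℝ r s) : False := by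
  rcases h with h | h
  · exact orient_ne_zero_of_mem_affineSegment h hx' (orient_eq_zero_of_mem_affineSegment hx)
  · exact orient_ne_zero_of_mem_affineSegment h hx (orient_eq_zero_of_mem_affineSegment hx')

theorem eq_of_mem_adjacent_affineSegment {p q r x : Plane} (h : orient p q r ≠ 0)
    (hx : x ∈ affineSegment ℝ p q) (hx' : x ∈ affineSegment ℝ q r) : x = q := by
  have h0 := orient_eq_zero_of_mem_affineSegment hx
  obtain ⟨t, -, rfl⟩ := hx'
  rw [orient_lineMap] at h0
  have : t = 0 := by simpa [h] using h0
  simp [this]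

/-- A nonzero turn makes consecutive edges meet only in their common vertex; all other pairs of
edges are disjoint by separation. -/
theorem Polygon.isSimple_of_separated {n : ℕ} (P : Polygon Plane n) (hn : 3 ≤ n)
    (hinj : Function.Injective P.vertices)
    (hturn : ∀ i, orient (P ((finRotate n).symm i)) (P i) (P (finRotate n i)) ≠ 0)
    (hsep : ∀ i j, i < j → j ≠ finRotate n i → i ≠ finRotate n j →
      Separated (P i) (P (finRotate n i)) (P j) (P (finRotate n j))) : P.IsSimple := by
  have adj : ∀ i j, j = finRotate n i → ∀ x, x ∈ P.edgeSet ℝ i → x ∈ P.edgeSet ℝ j → x = P j := by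
    rintro i j rfl x hx hx'
    refine eq_of_mem_adjacent_affineSegment ?_ hx hx'
    have := hturn (finRotate n i)
    rwa [Equiv.symm_apply_apply] at this
  refine ⟨hn, hinj, fun i j hij x ⟨hx, hx'⟩ => ?_⟩
  by_cases h1 : j = finRotate n i
  · have := adj i j h1 x hx hx'
    rw [this, h1]; simp
  by_cases h2 : i = finRotate n j
  · have := adj j i h2 x hx' hx
    rw [this, h2]; simp
  exfalso
  rcases lt_or_gt_of_ne hij with h | h
  · exact (hsep i j h h1 h2).disjoint hx hx'
  · exact (hsep j i h h2 h1).disjoint hx' hx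

/-- Turns the definition into finitely many polynomial inequalities, which can be checked edge by
edge for an explicit polygon; `T` is the set of corners. -/
theorem Polygon.isPseudoTriangle_of_orient {n : ℕ} (P : Polygon Plane n) (hn : 3 ≤ n)
    (hinj : Function.Injective P.vertices) (T : Finset (Fin n)) (hT : T.card = 3)
    (hpos : ∀ i ∈ T, 0 < orient (P ((finRotate n).symm i)) (P i) (P (finRotate n i)))
    (hneg : ∀ i ∉ T, orient (P ((finRotate n).symm i)) (P i) (P (finRotate n i)) < 0)
    (hsep : ∀ i j, i < j → j ≠ finRotate n i → i ≠ finRotate n j →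
      Separated (P i) (P (finRotate n i)) (P j) (P (finRotate n j)))
    (harea : 0 < ∑ i, cross (P i) (P (finRotate n i))) : P.IsPseudoTriangle := by
  have hturn : ∀ i, orient (P ((finRotate n).symm i)) (P i) (P (finRotate n i)) ≠ 0 := fun i => by
    by_cases h : i ∈ T
    · exact (hpos i h).ne'
    · exact (hneg i h).ne
  refine ⟨P.isSimple_of_separated hn hinj hturn hsep, half_pos harea, ?_⟩
  have : {i : Fin n | P.interiorAngle i < Real.pi} = T := by
    ext i
    rw [Set.mem_ofPred_eq, P.interiorAngle_lt_pi_iff i (hturn i), Finset.mem_coe]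
    constructor
    · intro h
      by_contra hi
      exact lt_asymm h (hneg i hi)
    · exact hpos i
  rw [this, Set.ncard_coe_finset, hT]

theorem separated_of_left_pos {p q r s : Plane} (h : 0 < orient p q r) (h' : 0 < orient p q s) :
    Separated p q r s := Or.inl (mul_pos h h')

theorem separated_of_right_pos {p q r s : Plane} (h : 0 < orient r s p) (h' : 0 < orient r s q) :
    Separated p q r s := Or.inr (mul_pos h h')

/-! ### Explicit pseudo-triangles with five and six vertices. -/

/-- The point `p` lies strictly inside the anticlockwise triangle `a b c`. -/
structure StrictlyInside (a b c p : Plane) : Prop where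
  left : 0 < orient a b p
  mid : 0 < orient b c p
  right : 0 < orient c a p

theorem StrictlyInside.rotate {a b c p : Plane} (h : StrictlyInside a b c p) :
    StrictlyInside b c a p := ⟨h.mid, h.right, h.left⟩

theorem StrictlyInside.orient_pos {a b c p : Plane} (h : StrictlyInside a b c p) :
    0 < orient a b c := by
  have : orient a b c = orient b c p + orient c a p + orient a b p := by
    simp only [orient_eq]; ring
  linarith [h.left, h.mid, h.right]

/-- A line through an interior point has vertices on both sides. -/
theorem StrictlyInside.orient_neg {a b c p : Plane} (h : StrictlyInside a b c p) (q : Plane)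
    (h1 : 0 < orient p q a) (h2 : 0 < orient p q b) : orient p q c < 0 := by
  -- Up to a positive factor, the first factors are the barycentric coordinates of `p`, and the
  -- affine function `orient p q` vanishes at `p`.
  have key : orient b c p * orient p q a + orient c a p * orient p q b +
      orient a b p * orient p q c = 0 := by
    simp only [orient_eq]; ring
  have h3 := mul_pos h.mid h1
  have h4 := mul_pos h.right h2
  by_contra! h5
  have := mul_nonneg h.left.le h5
  linarith

theorem StrictlyInside.orient_pos_or {a b c p : Plane} (h : StrictlyInside a b c p) (q : Plane)
    (h1 : orient p q b < 0) : 0 < orient p q a ∨ 0 < orient p q c := by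
  have key : orient b c p * orient p q a + orient c a p * orient p q b +
      orient a b p * orient p q c = 0 := by
    simp only [orient_eq]; ring
  by_contra! h5
  have h2 := mul_pos h.right (neg_pos.2 h1)
  have h3 := mul_nonneg h.mid.le (neg_nonneg.2 h5.1)
  have h4 := mul_nonneg h.left.le (neg_nonneg.2 h5.2)
  linarith

theorem injective_vec_of_pairwise_five {a d b c e : Plane}
    (h : List.Pairwise (· ≠ ·) [a, d, b, c, e]) : Function.Injective ![a, d, b, c, e] := by
  have := List.nodup_iff_injective_get.1 h
  intro i j hij
  refine this ?_
  fin_cases i <;> fin_cases j <;> exact hij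

/-- The polygon `a d b c e` is a pseudo-triangle with corners `a`, `b`, `c` if `d` and `e` lie in the
triangle `a b c` and the directed line `d e` has `a` on its left and `b`, `c` on its right. -/
theorem containsPseudoTriangle_five {S : Finset Plane} {a b c d e : Plane} (ha : a ∈ S)
    (hb : b ∈ S) (hc : c ∈ S) (hd : d ∈ S) (he : e ∈ S)
    (hd' : StrictlyInside a b c d) (he' : StrictlyInside a b c e)
    (h1 : 0 < orient d e a) (h2 : orient d e b < 0) (h3 : orient d e c < 0) :
    ContainsPseudoTriangle 5 S := by
  obtain ⟨hd1, hd2, hd3⟩ := hd'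
  have habc := he'.orient_pos
  obtain ⟨he1, he2, he3⟩ := he'
  have hne : List.Pairwise (· ≠ ·) [a, d, b, c, e] := by
    simp only [List.pairwise_cons, List.mem_cons, forall_eq_or_imp]
    refine ⟨⟨?_, ?_, ?_, ?_, by simp⟩, ⟨?_, ?_, ?_, by simp⟩, ⟨?_, ?_, by simp⟩,
      ⟨?_, by simp⟩, by simp⟩ <;> rintro rfl <;> simp at *
  have s1 : Separated a d b c := separated_of_right_pos (by rwa [orient_rotate]) hd2
  have s2 : Separated a d c e := separated_of_left_pos (by rwa [orient_rotate])
    (by rwa [← orient_rotate a d e])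
  have s3 : Separated d b c e := separated_of_left_pos (by rwa [← orient_rotate])
    (by rw [orient_swap]; linarith)
  have s4 : Separated d b e a := separated_of_right_pos (by rwa [orient_rotate])
    (by rwa [← orient_rotate])
  have s5 : Separated b c e a := separated_of_left_pos he2 (by rwa [orient_rotate])
  refine ⟨⟨![a, d, b, c, e]⟩, Polygon.isPseudoTriangle_of_orient _ (by norm_num)
    (injective_vec_of_pairwise_five hne) {0, 2, 3} (by decide) ?_ ?_ ?_ ?_, ?_⟩
  · intro i hi
    fin_cases i <;> simp at hi ⊢ <;> simp only [orient_eq] at * <;> linarith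
  · intro i hi
    fin_cases i <;> simp at hi ⊢ <;> simp only [orient_eq] at * <;> linarith
  · intro i j hij h1 h2
    fin_cases i <;> fin_cases j <;> simp at hij h1 h2 ⊢ <;> assumption
  · simp [Fin.sum_univ_five]
    simp only [orient_eq, cross] at *; linarith
  · intro i; fin_cases i <;> assumption

theorem injective_vec_of_pairwise_six {a x b y c z : Plane}
    (h : List.Pairwise (· ≠ ·) [a, x, b, y, c, z]) : Function.Injective ![a, x, b, y, c, z] := by
  have := List.nodup_iff_injective_get.1 h
  intro i j hij
  refine this ?_
  fin_cases i <;> fin_cases j <;> exact hij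

/-- The star-shaped hexagon `a x b y c z` with reflex vertices `x`, `y`, `z` in the triangle
`a b c`. -/
theorem containsPseudoTriangle_six_of_star {S : Finset Plane} {a b c x y z : Plane} (ha : a ∈ S)
    (hb : b ∈ S) (hc : c ∈ S) (hx : x ∈ S) (hy : y ∈ S) (hz : z ∈ S)
    (hx' : StrictlyInside a b c x) (hy' : StrictlyInside a b c y) (hz' : StrictlyInside a b c z)
    (h1 : 0 < orient a x z) (h2 : 0 < orient b y x) (h3 : 0 < orient c z y)
    (harea : 0 < orient a x z + orient b y x + orient c z y + orient x y z) :
    ContainsPseudoTriangle 6 S := by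
  have habc := hx'.orient_pos
  have i1 := hx'.orient_pos_or y (by rw [orient_rotate, orient_swap]; linarith)
  have i2 := hy'.rotate.orient_pos_or z (by rw [orient_rotate, orient_swap]; linarith)
  have i3 := hz'.rotate.rotate.orient_pos_or x (by rw [orient_rotate, orient_swap]; linarith)
  obtain ⟨hx1, hx2, hx3⟩ := hx'
  obtain ⟨hy1, hy2, hy3⟩ := hy'
  obtain ⟨hz1, hz2, hz3⟩ := hz'
  have hne : List.Pairwise (· ≠ ·) [a, x, b, y, c, z] := by
    simp only [List.pairwise_cons, List.mem_cons, forall_eq_or_imp]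
    refine ⟨⟨?_, ?_, ?_, ?_, ?_, by simp⟩, ⟨?_, ?_, ?_, ?_, by simp⟩, ⟨?_, ?_, ?_, by simp⟩,
      ⟨?_, ?_, by simp⟩, ⟨?_, by simp⟩, by simp⟩ <;> clear harea i1 i2 i3 <;>
      rintro rfl <;> simp at *
  have s02 : Separated a x b y := separated_of_right_pos (by rwa [orient_rotate]) h2
  have s24 : Separated b y c z := separated_of_right_pos (by rwa [orient_rotate]) h3
  have s04 : Separated a x c z := separated_of_left_pos (by rwa [orient_rotate]) h1
  have s13 : Separated x b y c := separated_of_left_pos (by rwa [← orient_rotate])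
    (by rwa [← orient_rotate])
  have s35 : Separated y c z a := separated_of_left_pos (by rwa [← orient_rotate])
    (by rwa [← orient_rotate])
  have s15 : Separated x b z a := separated_of_right_pos (by rwa [← orient_rotate])
    (by rwa [← orient_rotate])
  -- The line `x y` has `b` on its right, hence `a` or `c` on its left. In the first case the line
  -- `a x` separates these opposite edges, in the second the line `y c`.
  have s03 : Separated a x y c := by
    rcases i1 with h | h
    · exact separated_of_left_pos (by rwa [← orient_rotate]) (by rwa [orient_rotate])
    · exact separated_of_right_pos (by rwa [← orient_rotate]) (by rwa [orient_rotate])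
  have s25 : Separated b y z a := by
    rcases i2 with h | h
    · exact separated_of_left_pos (by rwa [← orient_rotate]) (by rwa [orient_rotate])
    · exact separated_of_right_pos (by rwa [← orient_rotate]) (by rwa [orient_rotate])
  have s14 : Separated x b c z := by
    rcases i3 with h | h
    · exact separated_of_right_pos (by rwa [← orient_rotate]) (by rwa [orient_rotate])
    · exact separated_of_left_pos (by rwa [← orient_rotate]) (by rwa [orient_rotate])
  refine ⟨⟨![a, x, b, y, c, z]⟩, Polygon.isPseudoTriangle_of_orient _ (by norm_num)
    (injective_vec_of_pairwise_six hne) {0, 2, 4} (by decide) ?_ ?_ ?_ ?_, ?_⟩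
  · clear i1 i2 i3
    intro i hi
    fin_cases i <;> simp at hi ⊢ <;> simp only [orient_eq] at * <;> linarith
  · clear i1 i2 i3
    intro i hi
    fin_cases i <;> simp at hi ⊢ <;> simp only [orient_eq] at * <;> linarith
  · intro i j hij h1 h2
    fin_cases i <;> fin_cases j <;> simp at hij h1 h2 ⊢ <;> assumption
  · simp [Fin.sum_univ_six]
    simp only [orient_eq, cross] at *; linarith
  · intro i; fin_cases i <;> assumption

/-! ### What two or three points inside a triangle force. -/

theorem exists_ccw_triangle {S : Finset Plane} (hS : InGeneralPosition S) {a b c : Plane}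
    (ha : a ∈ S) (hb : b ∈ S) (hc : c ∈ S) (hab : a ≠ b) (hac : a ≠ c) (hbc : b ≠ c) :
    ∃ a' ∈ S, ∃ b' ∈ S, ∃ c' ∈ S, 0 < orient a' b' c' ∧
      ∀ x ∈ insideTriangle S a b c, StrictlyInside a' b' c' x := by
  have main : ∀ a ∈ S, ∀ b ∈ S, ∀ c ∈ S, a ≠ b → a ≠ c → b ≠ c → 0 < orient a b c →
      ∀ x ∈ insideTriangle S a b c, StrictlyInside a b c x := by
    intro a ha b hb c hc hab hac hbc h x hx
    obtain ⟨hxS, hx, hxa, hxb, hxc⟩ := mem_insideTriangle.1 hx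
    refine ⟨orient_pos_of_mem_convexHull h hx ?_, orient_pos_of_mem_convexHull (a := b) (b := c)
      (c := a) (by rwa [orient_rotate]) (by rwa [Set.insert_comm, Set.pair_comm a c] at hx) ?_,
      orient_pos_of_mem_convexHull (a := c) (b := a) (c := b) (by rwa [← orient_rotate])
      (by rwa [Set.pair_comm, Set.insert_comm] at hx) ?_⟩
    · exact hS.orient_ne_zero ha hb hxS hab hxa.symm hxb.symm
    · exact hS.orient_ne_zero hb hc hxS hbc hxb.symm hxc.symm
    · exact hS.orient_ne_zero hc ha hxS hac.symm hxc.symm hxa.symm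
  rcases (hS.orient_ne_zero ha hb hc hab hac hbc).lt_or_gt with h | h
  · refine ⟨a, ha, c, hc, b, hb, by rw [orient_swap]; linarith, fun x hx => ?_⟩
    refine main a ha c hc b hb hac hab hbc.symm (by rw [orient_swap]; linarith) x ?_
    simp only [mem_insideTriangle] at hx ⊢
    rw [Set.pair_comm]
    tauto
  · exact ⟨a, ha, b, hb, c, hc, h, main a ha b hb c hc hab hac hbc h⟩

/-- Two points inside a triangle, labelled so that their line cuts off the corner `a`. -/
theorem exists_isolated_corner {S : Finset Plane} (hS : InGeneralPosition S) {a b c : Plane}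
    (ha : a ∈ S) (hb : b ∈ S) (hc : c ∈ S) (hab : a ≠ b) (hac : a ≠ c) (hbc : b ≠ c)
    (hcard : 2 ≤ (insideTriangle S a b c).card) :
    ∃ a ∈ S, ∃ b ∈ S, ∃ c ∈ S, ∃ d ∈ S, ∃ e ∈ S, StrictlyInside a b c d ∧
      StrictlyInside a b c e ∧ 0 < orient d e a ∧ orient d e b < 0 ∧ orient d e c < 0 := by
  obtain ⟨d, hd, e, he, hde⟩ := Finset.one_lt_card.1 hcard
  obtain ⟨a, ha, b, hb, c, hc, -, hin⟩ := exists_ccw_triangle hS ha hb hc hab hac hbc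
  have hdS := (mem_insideTriangle.1 hd).1
  have heS := (mem_insideTriangle.1 he).1
  have hd' := hin d hd
  have he' := hin e he
  have ne : ∀ v ∈ S, (v = a ∨ v = b ∨ v = c) → orient d e v ≠ 0 := by
    intro v hv hvv
    refine hS.orient_ne_zero hdS heS hv hde ?_ ?_
    · rintro rfl
      obtain ⟨h1, h2, h3⟩ := hd'
      rcases hvv with rfl | rfl | rfl <;> simp at h1 h2 h3
    · rintro rfl
      obtain ⟨h1, h2, h3⟩ := he'
      rcases hvv with rfl | rfl | rfl <;> simp at h1 h2 h3
  have one : ∀ a ∈ S, ∀ b ∈ S, ∀ c ∈ S, StrictlyInside a b c d → StrictlyInside a b c e →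
      ((0 < orient d e a ∧ orient d e b < 0 ∧ orient d e c < 0) ∨
      (orient d e a < 0 ∧ 0 < orient d e b ∧ 0 < orient d e c)) →
      ∃ a ∈ S, ∃ b ∈ S, ∃ c ∈ S, ∃ d ∈ S, ∃ e ∈ S, StrictlyInside a b c d ∧
      StrictlyInside a b c e ∧ 0 < orient d e a ∧ orient d e b < 0 ∧ orient d e c < 0 := by
    rintro a ha b hb c hc h1 h2 (h | h)
    · exact ⟨a, ha, b, hb, c, hc, d, hdS, e, heS, h1, h2, h⟩
    · refine ⟨a, ha, b, hb, c, hc, e, heS, d, hdS, h2, h1, ?_⟩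
      simpa only [orient_swap_left d e, Left.neg_pos_iff, Left.neg_neg_iff] using h
  -- The weights are positive, so the three corners are not all on one side of the line `d e`. One
  -- corner is alone on its side; rotating the triangle and exchanging `d` and `e` brings it to the
  -- required position.
  have key : orient b c d * orient d e a + orient c a d * orient d e b +
      orient a b d * orient d e c = 0 := by
    simp only [orient_eq]; ring
  rcases (ne a ha (by simp)).lt_or_gt with h1 | h1 <;>
    rcases (ne b hb (by simp)).lt_or_gt with h2 | h2 <;>
    rcases (ne c hc (by simp)).lt_or_gt with h3 | h3
  · nlinarith [mul_pos hd'.mid (neg_pos.2 h1), mul_pos hd'.right (neg_pos.2 h2),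
      mul_pos hd'.left (neg_pos.2 h3)]
  · exact one c hc a ha b hb hd'.rotate.rotate he'.rotate.rotate (Or.inl ⟨h3, h1, h2⟩)
  · exact one b hb c hc a ha hd'.rotate he'.rotate (Or.inl ⟨h2, h3, h1⟩)
  · exact one a ha b hb c hc hd' he' (Or.inr ⟨h1, h2, h3⟩)
  · exact one a ha b hb c hc hd' he' (Or.inl ⟨h1, h2, h3⟩)
  · exact one b hb c hc a ha hd'.rotate he'.rotate (Or.inr ⟨h2, h3, h1⟩)
  · exact one c hc a ha b hb hd'.rotate.rotate he'.rotate.rotate (Or.inr ⟨h3, h1, h2⟩)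
  · nlinarith [mul_pos hd'.mid h1, mul_pos hd'.right h2, mul_pos hd'.left h3]

theorem containsPseudoTriangle_five_of_two_inside {S : Finset Plane} (hS : InGeneralPosition S)
    {a b c : Plane} (ha : a ∈ S) (hb : b ∈ S) (hc : c ∈ S) (hab : a ≠ b) (hac : a ≠ c)
    (hbc : b ≠ c) (hcard : 2 ≤ (insideTriangle S a b c).card) : ContainsPseudoTriangle 5 S := by
  obtain ⟨a, ha, b, hb, c, hc, d, hd, e, he, hd', he', h1, h2, h3⟩ :=
    exists_isolated_corner hS ha hb hc hab hac hbc hcard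
  exact containsPseudoTriangle_five ha hb hc hd he hd' he' h1 h2 h3

theorem notMem_convexHull_of_convex_quadrilateral {p q r s : Plane} (h1 : 0 < orient p q r)
    (h3 : 0 < orient r s p) (h4 : 0 < orient s p q) : p ∉ convexHull ℝ {q, r, s} := by
  intro h
  -- The functional is `orient s p z + orient p q z`, the sum of those of the two sides at `p`: it
  -- vanishes at `p` and is positive at the other three vertices.
  have := affine_pos_of_mem_convexHull h
    (-(p 1 - s 1) - (q 1 - p 1)) ((p 0 - s 0) + (q 0 - p 0))
    (((p 1 - s 1) * s 0 - (p 0 - s 0) * s 1) + ((q 1 - p 1) * p 0 - (q 0 - p 0) * p 1)) (by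
      simp only [orient_eq] at h1 h3 h4
      simp only [Set.mem_insert_iff, Set.mem_singleton_iff, forall_eq_or_imp, forall_eq]
      refine ⟨?_, ?_, ?_⟩ <;> linarith)
  linarith

theorem containsConvexGon_four_of_convex_quadrilateral {S : Finset Plane} {p q r s : Plane}
    (hp : p ∈ S) (hq : q ∈ S) (hr : r ∈ S) (hs : s ∈ S) (h1 : 0 < orient p q r)
    (h2 : 0 < orient q r s) (h3 : 0 < orient r s p) (h4 : 0 < orient s p q) :
    ContainsConvexGon 4 S := by
  have hpq : p ≠ q := by rintro rfl; simp at h1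
  have hpr : p ≠ r := by rintro rfl; simp at h1
  have hps : p ≠ s := by rintro rfl; simp at h3
  have hqr : q ≠ r := by rintro rfl; simp at h1
  have hqs : q ≠ s := by rintro rfl; simp at h2
  have hrs : r ≠ s := by rintro rfl; simp at h2
  have hp' := notMem_convexHull_of_convex_quadrilateral h1 h3 h4
  have hq' := notMem_convexHull_of_convex_quadrilateral h2 h4 h1
  have hr' := notMem_convexHull_of_convex_quadrilateral h3 h1 h2
  have hs' := notMem_convexHull_of_convex_quadrilateral h4 h2 h3
  refine containsConvexGon_of_convexPosition (V := {p, q, r, s})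
    (by simp [Finset.insert_subset_iff, hp, hq, hr, hs]) ?_
    (by
      rw [Finset.card_insert_of_notMem, Finset.card_insert_of_notMem, Finset.card_pair hrs]
      · simp [hqr, hqs]
      · simp [hpq, hpr, hps])
  refine convexIndependent_set_iff_notMem_convexHull_sdiff.2 ?_
  simp only [Finset.coe_insert, Finset.coe_singleton, Set.mem_insert_iff, Set.mem_singleton_iff,
    forall_eq_or_imp, forall_eq]
  refine ⟨fun h => hp' (convexHull_mono ?_ h), fun h => hq' (convexHull_mono ?_ h),
    fun h => hr' (convexHull_mono ?_ h), fun h => hs' (convexHull_mono ?_ h)⟩ <;>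
  · intro x hx
    simp only [Set.mem_sdiff, Set.mem_insert_iff, Set.mem_singleton_iff] at hx ⊢
    tauto

/-- The line `d e` leaves `b` and `c` on one side, and the line `b c` leaves `d` and `e` on one
side, so `d b c e` is convex. -/
theorem containsConvexGon_four_of_two_inside {S : Finset Plane} (hS : InGeneralPosition S)
    {a b c : Plane} (ha : a ∈ S) (hb : b ∈ S) (hc : c ∈ S) (hab : a ≠ b) (hac : a ≠ c)
    (hbc : b ≠ c) (hcard : 2 ≤ (insideTriangle S a b c).card) : ContainsConvexGon 4 S := by
  obtain ⟨a, ha, b, hb, c, hc, d, hd, e, he, hd', he', h1, h2, h3⟩ :=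
    exists_isolated_corner hS ha hb hc hab hac hbc hcard
  refine containsConvexGon_four_of_convex_quadrilateral hd hb hc he ?_ he'.mid ?_ ?_
  · rw [← orient_rotate]; exact hd'.mid
  · rw [orient_rotate, orient_swap]; linarith
  · rw [orient_swap_left]; linarith

/-- Among points inside a triangle, one is the first in angular order around the corner `a`. -/
theorem exists_first {S T : Finset Plane} (hS : InGeneralPosition S) (hTS : T ⊆ S)
    (hT : T.Nonempty) {a b c : Plane} (ha : a ∈ S)
    (hin : ∀ x ∈ T, StrictlyInside a b c x) :
    ∃ p ∈ T, ∀ q ∈ T, q ≠ p → 0 < orient a p q := by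
  -- Up to a constant this is the ratio of the distances of `x` from the sides `a b` and `a c`; it
  -- increases as the ray from `a` turns from `b` to `c`.
  obtain ⟨p, hp, hmin⟩ := T.exists_min_image (fun x => orient a b x / orient c a x) hT
  refine ⟨p, hp, fun q hq hqp => ?_⟩
  have hap : a ≠ p := by rintro rfl; simpa using (hin _ hp).left
  have haq : a ≠ q := by rintro rfl; simpa using (hin _ hq).left
  refine lt_of_le_of_ne ?_ (hS.orient_ne_zero ha (hTS hp) (hTS hq) hap haq hqp.symm).symm
  have h := hmin q hq
  rw [div_le_div_iff₀ (hin p hp).right (hin q hq).right] at h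
  have key : orient a b q * orient c a p - orient a b p * orient c a q =
      orient a b c * orient a p q := by
    simp only [orient_eq]; ring
  exact nonneg_of_mul_nonneg_right (by linarith) (hin p hp).orient_pos

/-- The star hexagon when one interior point comes first around two corners. -/
theorem containsPseudoTriangle_six_of_common_first {S T : Finset Plane}
    (hS : InGeneralPosition S) (hTS : T ⊆ S) (hT : T.card = 3) {a b c y : Plane} (ha : a ∈ S)
    (hb : b ∈ S) (hc : c ∈ S) (hin : ∀ x ∈ T, StrictlyInside a b c x) (hy : y ∈ T)
    (hya : ∀ q ∈ T, q ≠ y → 0 < orient a y q) (hyb : ∀ q ∈ T, q ≠ y → 0 < orient b y q) :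
    ContainsPseudoTriangle 6 S := by
  classical
  have main : ∀ x ∈ T, ∀ z ∈ T, x ≠ y → z ≠ y → x ≠ z → 0 < orient a x z →
      ContainsPseudoTriangle 6 S := by
    intro x hx z hz hxy hzy hxz h
    have hzc : 0 < orient c z y := by
      have := (hin y hy).orient_neg z (by rw [orient_rotate]; exact hya z hz hzy)
        (by rw [orient_rotate]; exact hyb z hz hzy)
      rw [orient_rotate] at this
      rw [orient_swap]; linarith
    refine containsPseudoTriangle_six_of_star ha hb hc (hTS hx) (hTS hy) (hTS hz) (hin x hx)
      (hin y hy) (hin z hz) h (hyb x hx hxy) hzc ?_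
    have hbx : b ≠ x := by rintro rfl; simpa using (hin _ hx).left
    have hbz : b ≠ z := by rintro rfl; simpa using (hin _ hz).left
    have hay := hya x hx hxy
    have hby := hyb x hx hxy
    have hbyz := hyb z hz hzy
    -- The area becomes a sum of positive triangles once the middle triangle and an ear are split
    -- along the other diagonal: `x y c z` along `x c` in the first case, `b y z x` along `b z` in
    -- the second.
    rcases (hS.orient_ne_zero hb (hTS hz) (hTS hx) hbz hbx hxz.symm).lt_or_gt with h1 | h1
    · have h2 := (hin y hy).orient_neg x (by rwa [orient_rotate]) (by rwa [orient_rotate])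
      have h3 := (hin x hx).orient_neg z (by rwa [orient_rotate])
        (by rw [orient_rotate, orient_swap]; linarith)
      simp only [orient_eq] at *
      linarith
    · simp only [orient_eq] at *
      linarith
  have hcard : (T.erase y).card = 2 := by rw [Finset.card_erase_of_mem hy, hT]
  obtain ⟨x, z, hxz, he⟩ := Finset.card_eq_two.1 hcard
  obtain ⟨hxy, hx⟩ := Finset.mem_erase.1 (show x ∈ T.erase y by simp [he])
  obtain ⟨hzy, hz⟩ := Finset.mem_erase.1 (show z ∈ T.erase y by simp [he])
  have hax : a ≠ x := by rintro rfl; simpa using (hin _ hx).left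
  have haz : a ≠ z := by rintro rfl; simpa using (hin _ hz).left
  rcases (hS.orient_ne_zero ha (hTS hx) (hTS hz) hax haz hxz).lt_or_gt with h | h
  · exact main z hz x hx hzy hxy hxz.symm (by rw [orient_swap]; linarith)
  · exact main x hx z hz hxy hzy hxz h

/-- The star hexagon when the first points around the three corners are distinct. -/
theorem containsPseudoTriangle_six_of_distinct_first {S : Finset Plane}
    (hS : InGeneralPosition S) {a b c x y z : Plane} (ha : a ∈ S)
    (hb : b ∈ S) (hc : c ∈ S) (hx : x ∈ S) (hy : y ∈ S) (hz : z ∈ S)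
    (hx' : StrictlyInside a b c x) (hy' : StrictlyInside a b c y) (hz' : StrictlyInside a b c z)
    (hxy : x ≠ y) (hxz : x ≠ z) (hyz : y ≠ z)
    (haxy : 0 < orient a x y) (haxz : 0 < orient a x z) (hbyx : 0 < orient b y x)
    (hbyz : 0 < orient b y z) (hczx : 0 < orient c z x) (hczy : 0 < orient c z y) :
    ContainsPseudoTriangle 6 S := by
  refine containsPseudoTriangle_six_of_star ha hb hc hx hy hz hx' hy' hz' haxz hbyx hczy ?_
  have hay : a ≠ y := by rintro rfl; simpa using hy'.left
  have haz : a ≠ z := by rintro rfl; simpa using hz'.left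
  have hbx : b ≠ x := by rintro rfl; simpa using hx'.left
  have hbz : b ≠ z := by rintro rfl; simpa using hz'.left
  rcases (hS.orient_ne_zero ha hy hz hay haz hyz).lt_or_gt with h1 | h1
  swap
  · simp only [orient_eq] at *; linarith
  rcases (hS.orient_ne_zero hb hz hx hbz hbx hxz.symm).lt_or_gt with h2 | h2
  swap
  · simp only [orient_eq] at *; linarith
  suffices h : 0 < orient x y z by linarith
  -- Only when neither change of diagonal works must `x y z` itself be shown positive. The first two
  -- Plücker relations compare products; multiplying the comparisons gives the sign in the third.
  have k1 : orient a b z * orient c z x - orient c a z * orient b x z =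
      orient b c z * orient a x z := by
    simp only [orient_eq]; ring
  have k2 : orient c a z * orient b y z - orient a b z * orient c z y =
      orient b c z * orient a z y := by
    simp only [orient_eq]; ring
  have k3 : orient c z x * orient b y z - orient b x z * orient c z y =
      orient b c z * orient x y z := by
    simp only [orient_eq]; ring
  have hazy : 0 < orient a z y := by rw [orient_swap]; linarith
  have hbxz : 0 < orient b x z := by rw [orient_swap]; linarith
  have p1 := mul_pos hz'.mid haxz
  have p2 := mul_pos hz'.mid hazy
  have l1 : orient c a z * orient b x z < orient a b z * orient c z x := by linarith
  have l2 : orient a b z * orient c z y < orient c a z * orient b y z := by linarith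
  have l3 := mul_lt_mul'' l1 l2 (mul_pos hz'.right hbxz).le (mul_pos hz'.left hczy).le
  have l4 : 0 < (orient a b z * orient c a z) * (orient b c z * orient x y z) := by
    rw [← k3]; linarith
  exact (mul_pos_iff_of_pos_left hz'.mid).1
    ((mul_pos_iff_of_pos_left (mul_pos hz'.left hz'.right)).1 l4)

/-- Take the first interior point around each corner: either two corners share theirs, or the three
are distinct and serve as the reflex vertices. -/
theorem containsPseudoTriangle_six_of_three_inside {S : Finset Plane} (hS : InGeneralPosition S)
    {a b c : Plane} (ha : a ∈ S) (hb : b ∈ S) (hc : c ∈ S) (hab : a ≠ b) (hac : a ≠ c)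
    (hbc : b ≠ c) (hcard : 3 ≤ (insideTriangle S a b c).card) : ContainsPseudoTriangle 6 S := by
  obtain ⟨T, hTi, hT⟩ := Finset.exists_subset_card_eq hcard
  obtain ⟨a, ha, b, hb, c, hc, -, hin⟩ := exists_ccw_triangle hS ha hb hc hab hac hbc
  have hTS : T ⊆ S := fun x hx => (mem_insideTriangle.1 (hTi hx)).1
  have h1 : ∀ x ∈ T, StrictlyInside a b c x := fun x hx => hin x (hTi hx)
  have h2 : ∀ x ∈ T, StrictlyInside b c a x := fun x hx => (h1 x hx).rotate
  have h3 : ∀ x ∈ T, StrictlyInside c a b x := fun x hx => (h2 x hx).rotate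
  have hne : T.Nonempty := Finset.card_pos.1 (by lia)
  obtain ⟨x, hx, hxa⟩ := exists_first hS hTS hne ha h1
  obtain ⟨y, hy, hyb⟩ := exists_first hS hTS hne hb h2
  obtain ⟨z, hz, hzc⟩ := exists_first hS hTS hne hc h3
  by_cases hxy : x = y
  · subst hxy
    exact containsPseudoTriangle_six_of_common_first hS hTS hT ha hb hc h1 hx hxa hyb
  by_cases hyz : y = z
  · subst hyz
    exact containsPseudoTriangle_six_of_common_first hS hTS hT hb hc ha h2 hy hyb hzc
  by_cases hxz : x = z
  · subst hxz
    exact containsPseudoTriangle_six_of_common_first hS hTS hT hc ha hb h3 hx hzc hxa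
  exact containsPseudoTriangle_six_of_distinct_first hS ha hb hc (hTS hx) (hTS hy) (hTS hz)
    (h1 x hx) (h1 y hy) (h1 z hz) hxy hxz hyz (hxa y hy (Ne.symm hxy)) (hxa z hz (Ne.symm hxz))
    (hyb x hx hxy) (hyb z hz (Ne.symm hyz)) (hzc x hx hxz) (hzc y hy hyz)

/-! ### All hull vertices of a simple polygon turn the same way. -/

-- If `y / x` were real and nonpositive, then 0 would lie between `x` and `y`. The slit plane is
-- where `arg` is continuous.
open Complex in
theorem div_mem_slitPlane_of_zero_notMem_segment {x y : ℂ} (h : (0 : ℂ) ∉ segment ℝ x y) :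
    y / x ∈ slitPlane := by
  have hx : x ≠ 0 := by rintro rfl; exact h (left_mem_segment ℝ _ _)
  rw [mem_slitPlane_iff_not_le_zero]
  intro hle
  obtain ⟨hre, him⟩ := Complex.le_def.1 hle
  simp only [zero_re, zero_im] at hre him
  set r : ℝ := -(y / x).re with hr
  have hr0 : 0 ≤ r := by linarith
  have hy : y = -(r : ℂ) * x := by
    have : y / x = -(r : ℂ) := by
      apply Complex.ext <;> simp [hr, him]
    rw [← this]; field_simp
  refine h ⟨r / (1 + r), 1 / (1 + r), by positivity, by positivity, by field_simp; ring, ?_⟩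
  rw [hy]
  simp only [real_smul]
  push_cast
  ring

open Complex in
theorem mem_slitPlane_of_im_ne_zero {z : ℂ} (h : z.im ≠ 0) : z ∈ slitPlane := Or.inr h

/-- The values are multiples of 2π, a discrete set, and the interval is connected. -/
theorem eq_of_continuousOn_of_coe_angle_eq_zero {f : ℝ → ℝ} (hf : ContinuousOn f (Set.Icc 0 1))
    (h : ∀ t ∈ Set.Icc (0 : ℝ) 1, (f t : Real.Angle) = 0) : f 0 = f 1 := by
  have hmaps : Set.MapsTo f (Set.Icc 0 1) (AddSubgroup.zmultiples (2 * Real.pi)) := by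
    intro t ht
    obtain ⟨k, hk⟩ := Real.Angle.coe_eq_zero_iff.1 (h t ht)
    exact ⟨k, hk⟩
  exact isPreconnected_Icc.constant_of_mapsTo ⟨inferInstanceAs
    (DiscreteTopology (AddSubgroup.zmultiples (2 * Real.pi)))⟩ hf hmaps
    (Set.left_mem_Icc.2 zero_le_one) (Set.right_mem_Icc.2 zero_le_one)

open Complex in
/-- The angle under which a closed path is seen does not change along one of its edges `A B`, when
the half turn made at the point itself is counted as well. -/
theorem angle_sum_eq_of_edge {A B : ℂ} {Q : ℕ → ℂ} {m : ℕ}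
    (h0 : ((Q 0 - A) / (B - A)).im ≠ 0) (hm : ((Q m - A) / (B - A)).im ≠ 0)
    (hQ : ∀ j < m, ∀ z ∈ segment ℝ A B, z ∉ segment ℝ (Q j) (Q (j + 1))) :
    Real.pi + arg ((B - A) / (A - Q m)) + arg ((Q 0 - A) / (B - A)) +
      ∑ j ∈ Finset.range m, arg ((Q (j + 1) - A) / (Q j - A)) =
    Real.pi + arg ((B - A) / (B - Q m)) + arg ((Q 0 - B) / (B - A)) +
      ∑ j ∈ Finset.range m, arg ((Q (j + 1) - B) / (Q j - B)) := by
  have hAB : B - A ≠ 0 := by rintro h; simp [h] at h0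
  set z : ℝ → ℂ := fun t => A + t * (B - A) with hz
  have hzc : Continuous z := by fun_prop
  have hzseg : ∀ t ∈ Set.Icc (0 : ℝ) 1, z t ∈ segment ℝ A B := by
    intro t ht
    refine ⟨1 - t, t, by linarith [ht.2], ht.1, by ring, ?_⟩
    simp only [hz, real_smul]; push_cast; ring
  -- Moving along the edge changes these quotients by a real number only, so their imaginary parts
  -- stay nonzero and no argument jumps.
  have e0 : ∀ t, (Q 0 - z t) / (B - A) = (Q 0 - A) / (B - A) - t := by
    intro t; simp only [hz]; field_simp; ring
  have em : ∀ t, (z t - Q m) / (B - A) = t - (Q m - A) / (B - A) := by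
    intro t; simp only [hz]; field_simp; ring
  have i0 : ∀ t, ((Q 0 - z t) / (B - A)).im ≠ 0 := by
    intro t; rw [e0]; simpa using h0
  have im' : ∀ t, ((z t - Q m) / (B - A)).im ≠ 0 := by
    intro t; rw [em]; simpa using hm
  have n0 : ∀ t, Q 0 - z t ≠ 0 := by intro t h; apply i0 t; simp [h]
  have nm : ∀ t, z t - Q m ≠ 0 := by intro t h; apply im' t; simp [h]
  have sm : ∀ t, (B - A) / (z t - Q m) ∈ slitPlane := by
    intro t
    apply mem_slitPlane_of_im_ne_zero
    rw [← inv_div, inv_im]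
    have := im' t
    have h2 : (z t - Q m) / (B - A) ≠ 0 := div_ne_zero (nm t) hAB
    simp [this]
    tauto
  have hseg0 : ∀ t ∈ Set.Icc (0 : ℝ) 1, ∀ j < m,
      (0 : ℂ) ∉ segment ℝ (Q j - z t) (Q (j + 1) - z t) := by
    rintro t ht j hj ⟨a, b, ha, hb, hab, h⟩
    refine hQ j hj _ (hzseg t ht) ⟨a, b, ha, hb, hab, ?_⟩
    have hab' : (a : ℂ) + b = 1 := by exact_mod_cast hab
    simp only [real_smul] at h ⊢
    linear_combination h + z t * hab'
  have nQ : ∀ t ∈ Set.Icc (0 : ℝ) 1, ∀ j ≤ m, Q j - z t ≠ 0 := by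
    intro t ht j hj h
    rcases hj.eq_or_lt with rfl | hj
    · apply nm t; linear_combination -h
    · exact hseg0 t ht j hj (h ▸ left_mem_segment ℝ _ _)
  have hcont : ContinuousOn (fun t => Real.pi + arg ((B - A) / (z t - Q m)) +
      arg ((Q 0 - z t) / (B - A)) +
      ∑ j ∈ Finset.range m, arg ((Q (j + 1) - z t) / (Q j - z t))) (Set.Icc 0 1) := by
    refine ((continuousOn_const.add ?_).add ?_).add (continuousOn_finsetSum _ fun j hj => ?_)
    · intro t ht
      refine ContinuousAt.comp_continuousWithinAt (f := fun t => (B - A) / (z t - Q m))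
        (continuousAt_arg (sm t)) ?_
      exact (continuousWithinAt_const.div (by fun_prop) (nm t))
    · intro t ht
      refine ContinuousAt.comp_continuousWithinAt (f := fun t => (Q 0 - z t) / (B - A))
        (continuousAt_arg (mem_slitPlane_of_im_ne_zero (i0 t))) ?_
      fun_prop
    · intro t ht
      have hj := Finset.mem_range.1 hj
      refine ContinuousAt.comp_continuousWithinAt (f := fun t => (Q (j + 1) - z t) / (Q j - z t))
        (continuousAt_arg (div_mem_slitPlane_of_zero_notMem_segment (hseg0 t ht j hj))) ?_
      exact ContinuousWithinAt.div (by fun_prop) (by fun_prop) (nQ t ht j hj.le)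
  -- Modulo 2π the arguments telescope to that of `Q m - z t` minus that of `z t - Q m`, a half
  -- turn, which the added π completes.
  have := eq_of_continuousOn_of_coe_angle_eq_zero hcont (by
    intro t ht
    have hsum : ∀ k ≤ m, ((∑ j ∈ Finset.range k, arg ((Q (j + 1) - z t) / (Q j - z t)) : ℝ) :
        Real.Angle) = arg (Q k - z t) - arg (Q 0 - z t) := by
      intro k
      induction k with
      | zero => simp
      | succ k ih =>
        intro hk
        rw [Finset.sum_range_succ, Real.Angle.coe_add, ih (by lia),
          arg_div_coe_angle (nQ t ht _ hk) (nQ t ht _ (by lia))]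
        abel
    have hneg := arg_neg_coe_angle (nm t)
    rw [neg_sub] at hneg
    simp only [Real.Angle.coe_add]
    rw [hsum m le_rfl, arg_div_coe_angle hAB (nm t), arg_div_coe_angle (n0 t) hAB, hneg]
    have h2 : (Real.pi : Real.Angle) + Real.pi = 0 := Real.Angle.coe_pi_add_coe_pi
    calc _ = (Real.pi : Real.Angle) + Real.pi := by abel
      _ = 0 := h2)
  simpa [hz] using this

open Complex in
theorem arg_div_of_re_pos {x y : ℂ} (hx : 0 < x.re) (hy : 0 < y.re) :
    arg (x / y) = arg x - arg y := by
  have hx0 : x ≠ 0 := by rintro rfl; simp at hx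
  have hy0 : y ≠ 0 := by rintro rfl; simp at hy
  have h1 := abs_lt.1 (abs_arg_lt_pi_div_two_iff.2 (Or.inl hx))
  have h2 := abs_lt.1 (abs_arg_lt_pi_div_two_iff.2 (Or.inl hy))
  rw [← arg_coe_angle_toReal_eq_arg (x / y), arg_div_coe_angle hx0 hy0, ← Real.Angle.coe_sub,
    Real.Angle.toReal_coe_eq_self_iff]
  constructor <;> linarith

-- For `w` the quotient of the vectors from a vertex to its predecessor and to its successor, `-w⁻¹`
-- carries the exterior angle. The two arguments add up to π or -π, according to the sign of the
-- imaginary part.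
open Complex in
theorem pi_add_arg_neg_inv_add_arg {w : ℂ} (hw : w.im ≠ 0) :
    Real.pi + arg (-w⁻¹) + arg w = if 0 < w.im then 2 * Real.pi else 0 := by
  have hw0 : w ≠ 0 := by rintro rfl; simp at hw
  have hn : 0 < normSq w := normSq_pos.2 hw0
  have hpi : arg w ≠ Real.pi := by
    intro h; exact hw (arg_eq_pi_iff.1 h).2
  split_ifs with h
  · rw [arg_neg_eq_arg_add_pi_of_im_neg, arg_inv, if_neg hpi]
    · ring
    · rw [inv_im]; exact div_neg_of_neg_of_pos (by linarith) hn
  · have : w.im < 0 := lt_of_le_of_ne (not_lt.1 h) hw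
    rw [arg_neg_eq_arg_sub_pi_of_im_pos, arg_inv, if_neg hpi]
    · ring
    · rw [inv_im]; exact div_pos (by linarith) hn

open Complex in
/-- The angle under which the closed path `p 0, …, p (m + 2)` is seen from its vertex `p i`,
increased by the exterior angle at `p i` and a half turn. -/
noncomputable def vertexAngleSum (m : ℕ) (p : ℕ → ℂ) (i : ℕ) : ℝ :=
  Real.pi + arg ((p (i + 1) - p i) / (p i - p (i + m + 2))) +
    ∑ j ∈ Finset.range (m + 1), arg ((p (i + j + 2) - p i) / (p (i + j + 1) - p i))

-- The viewpoint slides along the edge to the next vertex; the `m` edges of the (m + 3)-gon not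
-- adjacent to this edge do not meet it.
open Complex in
theorem vertexAngleSum_succ {m : ℕ} {p : ℕ → ℂ} (hper : ∀ i, p (i + m + 3) = p i) {i : ℕ}
    (h0 : ((p (i + 2) - p i) / (p (i + 1) - p i)).im ≠ 0)
    (hm : ((p (i + m + 2) - p i) / (p (i + 1) - p i)).im ≠ 0)
    (hQ : ∀ j < m, ∀ z ∈ segment ℝ (p i) (p (i + 1)),
      z ∉ segment ℝ (p (i + j + 2)) (p (i + j + 3))) :
    vertexAngleSum m p i = vertexAngleSum m p (i + 1) := by
  have := angle_sum_eq_of_edge (A := p i) (B := p (i + 1)) (Q := fun j => p (i + j + 2)) (m := m)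
    (by simpa using h0) (by simpa using hm) (by
      intro j hj z hz; simpa only [show i + (j + 1) + 2 = i + j + 3 by ring] using hQ j hj z hz)
  unfold vertexAngleSum
  rw [Finset.sum_range_succ', Finset.sum_range_succ (n := m)]
  have e1 : p (i + 1 + m + 2) = p i := by rw [← hper i]; congr 1; ring
  have e2 : arg ((p (i + 1 + m + 2) - p (i + 1)) / (p (i + 1 + m + 1) - p (i + 1))) =
      arg ((p (i + 1) - p i) / (p (i + 1) - p (i + m + 2))) := by
    rw [e1, ← neg_div_neg_eq, neg_sub, neg_sub]
    congr 3; congr 1; ring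
  rw [e2, e1]
  have e3 : ∀ j, i + 1 + j + 2 = i + (j + 1) + 2 := by intro j; ring
  have e4 : ∀ j, i + 1 + j + 1 = i + j + 2 := by intro j; ring
  have e5 : ∀ j, i + (j + 1) + 1 = i + j + 2 := by intro j; ring
  simp only [e3, e4, e5, add_zero] at this ⊢
  linarith

-- After multiplication by `d` all other vertices are seen in the right half-plane, where arguments
-- subtract without wrapping; the sum telescopes to the angle between the two edges at `p i`.
open Complex in
theorem vertexAngleSum_of_extreme {m : ℕ} {p : ℕ → ℂ} {i : ℕ} (d : ℂ)
    (hd : ∀ j, 1 ≤ j → j ≤ m + 2 → 0 < ((p (i + j) - p i) * d).re)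
    (hm : ((p (i + m + 2) - p i) / (p (i + 1) - p i)).im ≠ 0) :
    vertexAngleSum m p i =
      if 0 < ((p (i + m + 2) - p i) / (p (i + 1) - p i)).im then 2 * Real.pi else 0 := by
  have hd0 : d ≠ 0 := by
    rintro rfl; simpa using hd 1 le_rfl (by lia)
  have hdiv : ∀ j k, 1 ≤ j → j ≤ m + 2 → 1 ≤ k → k ≤ m + 2 →
      arg ((p (i + j) - p i) / (p (i + k) - p i)) =
        arg ((p (i + j) - p i) * d) - arg ((p (i + k) - p i) * d) := by
    intro j k hj hj' hk hk'
    rw [← arg_div_of_re_pos (hd j hj hj') (hd k hk hk'), mul_div_mul_right _ _ hd0]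
  have hsum : ∀ k ≤ m + 1, ∑ j ∈ Finset.range k,
      arg ((p (i + j + 2) - p i) / (p (i + j + 1) - p i)) =
      arg ((p (i + (k + 1)) - p i) * d) - arg ((p (i + 1) - p i) * d) := by
    intro k
    induction k with
    | zero => simp
    | succ k ih =>
      intro hk
      rw [Finset.sum_range_succ, ih (by lia), add_assoc i k 2, add_assoc i k 1,
        hdiv _ _ (by lia) (by lia) (by lia) (by lia)]
      ring
  rw [← pi_add_arg_neg_inv_add_arg hm]
  unfold vertexAngleSum
  rw [hsum _ le_rfl, ← hdiv _ _ (by lia) (by lia) (by lia) (by lia)]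
  have : -((p (i + m + 2) - p i) / (p (i + 1) - p i))⁻¹ =
      (p (i + 1) - p i) / (p i - p (i + m + 2)) := by
    rw [inv_div, ← div_neg, neg_sub]
  rw [this]
  rfl

/-- The plane as the complex numbers. -/
noncomputable def Plane.toComplex (z : Plane) : ℂ := ⟨z 0, z 1⟩

theorem Plane.toComplex_injective : Function.Injective Plane.toComplex := fun _ _ h =>
  Plane.ext_coord (congrArg Complex.re h) (congrArg Complex.im h)

theorem Plane.exists_of_mem_segment_toComplex {a b : Plane} {z : ℂ}
    (hz : z ∈ segment ℝ a.toComplex b.toComplex) : ∃ x ∈ affineSegment ℝ a b, x.toComplex = z := by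
  obtain ⟨s, t, hs, ht, hst, rfl⟩ := hz
  refine ⟨AffineMap.lineMap a b t, ⟨t, ⟨ht, by linarith⟩, rfl⟩, ?_⟩
  obtain rfl : s = 1 - t := by linarith
  apply Complex.ext <;> simp [Plane.toComplex, AffineMap.lineMap_apply] <;> ring

theorem Plane.im_div_toComplex (a b c : Plane) :
    ((c.toComplex - a.toComplex) / (b.toComplex - a.toComplex)).im =
      orient a b c / Complex.normSq (b.toComplex - a.toComplex) := by
  rw [Complex.div_im, orient_eq]
  simp only [Plane.toComplex, Complex.sub_re, Complex.sub_im]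
  ring

theorem Plane.im_div_toComplex_pos_iff {a b c : Plane} (h : a ≠ b) :
    0 < ((c.toComplex - a.toComplex) / (b.toComplex - a.toComplex)).im ↔ 0 < orient a b c := by
  have : 0 < Complex.normSq (b.toComplex - a.toComplex) :=
    Complex.normSq_pos.2 (sub_ne_zero.2 fun h' => h (Plane.toComplex_injective h').symm)
  rw [Plane.im_div_toComplex, div_pos_iff_of_pos_right this]

theorem Plane.im_div_toComplex_ne_zero {a b c : Plane} (h : orient a b c ≠ 0) :
    ((c.toComplex - a.toComplex) / (b.toComplex - a.toComplex)).im ≠ 0 := by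
  have hab : a ≠ b := by rintro rfl; simp at h
  have : Complex.normSq (b.toComplex - a.toComplex) ≠ 0 :=
    (Complex.normSq_pos.2 (sub_ne_zero.2 fun h' => hab (Plane.toComplex_injective h').symm)).ne'
  rw [Plane.im_div_toComplex]
  exact div_ne_zero h this

/-- A point outside the hull of a finite set sees that set in an open half-plane. -/
theorem exists_halfPlane_of_notMem_convexHull {T : Set Plane} (hT : T.Finite) {v : Plane}
    (hv : v ∉ convexHull ℝ T) :
    ∃ d : ℂ, ∀ x ∈ T, 0 < ((x.toComplex - v.toComplex) * d).re := by
  obtain ⟨f, u, hu, hf⟩ := geometric_hahn_banach_point_closed (convex_convexHull ℝ T)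
    (hT.isCompact_convexHull ℝ).isClosed hv
  have hfz : ∀ z : Plane, f z = z 0 * f (EuclideanSpace.single 0 1) +
      z 1 * f (EuclideanSpace.single 1 1) := by
    intro z
    have : z = z 0 • EuclideanSpace.single 0 (1 : ℝ) + z 1 • EuclideanSpace.single 1 (1 : ℝ) := by
      apply Plane.ext_coord <;> simp
    conv_lhs => rw [this]
    simp only [map_add, map_smul, smul_eq_mul]
  -- The conjugate of the gradient of `f`: the real part of the product with it is `f`.
  refine ⟨⟨f (EuclideanSpace.single 0 1), -f (EuclideanSpace.single 1 1)⟩, fun x hx => ?_⟩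
  have h1 := hf x (subset_convexHull ℝ T hx)
  rw [hfz] at hu h1
  simp only [Plane.toComplex, Complex.mul_re, Complex.sub_re, Complex.sub_im]
  linarith

theorem Fin.ofNat_add_ne {n i a b : ℕ} [NeZero n] (ha : a < n) (hb : b < n) (hab : a ≠ b) :
    (Fin.ofNat n (i + a)) ≠ (Fin.ofNat n (i + b)) := by
  intro h
  have h1 : (i + a) % n = (i + b) % n := by simpa using congrArg Fin.val h
  have h2 : a ≡ b [MOD n] := Nat.ModEq.add_left_cancel' i h1
  exact hab (Nat.ModEq.eq_of_lt_of_lt h2 ha hb)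

namespace Polygon

variable {m : ℕ} {P : Polygon Plane (m + 3)}

/-- The vertices of a polygon as a periodic sequence of complex numbers. -/
noncomputable def complexVertex (P : Polygon Plane (m + 3)) (i : ℕ) : ℂ :=
  (P (Fin.ofNat (m + 3) i)).toComplex

theorem complexVertex_periodic (i : ℕ) : P.complexVertex (i + m + 3) = P.complexVertex i := by
  unfold complexVertex
  congr 2
  ext
  simp [add_assoc]

theorem finRotate_ofNat (i : ℕ) :
    finRotate (m + 3) (Fin.ofNat (m + 3) i) = (Fin.ofNat (m + 3) (i + 1)) := by
  rw [finRotate_apply]; ext; simp [Fin.val_add]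

theorem finRotate_symm_ofNat (i : ℕ) :
    (finRotate (m + 3)).symm (Fin.ofNat (m + 3) i) = (Fin.ofNat (m + 3) (i + m + 2)) := by
  rw [Equiv.symm_apply_eq, finRotate_ofNat]
  ext
  simp [add_assoc]

theorem IsSimple.disjoint_edges (hP : P.IsSimple) (i : ℕ) {j : ℕ} (hj : j < m) {x : Plane}
    (hx : x ∈ affineSegment ℝ (P (Fin.ofNat (m + 3) i)) (P (Fin.ofNat (m + 3) (i + 1))))
    (hx' : x ∈ affineSegment ℝ (P (Fin.ofNat (m + 3) (i + j + 2)))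
      (P (Fin.ofNat (m + 3) (i + j + 3)))) : False := by
  obtain ⟨-, hinj, hsim⟩ := hP
  have n1 : (Fin.ofNat (m + 3) (i + (j + 2))) ≠ (Fin.ofNat (m + 3) (i + 0)) :=
    Fin.ofNat_add_ne (by lia) (by lia) (by lia)
  have n2 : (Fin.ofNat (m + 3) (i + (j + 3))) ≠ (Fin.ofNat (m + 3) (i + 0)) :=
    Fin.ofNat_add_ne (by lia) (by lia) (by lia)
  have n3 : (Fin.ofNat (m + 3) (i + (j + 2))) ≠ (Fin.ofNat (m + 3) (i + 1)) :=
    Fin.ofNat_add_ne (by lia) (by lia) (by lia)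
  have n4 : (Fin.ofNat (m + 3) (i + (j + 3))) ≠ (Fin.ofNat (m + 3) (i + 1)) :=
    Fin.ofNat_add_ne (by lia) (by lia) (by lia)
  have h := hsim (Fin.ofNat (m + 3) i) (Fin.ofNat (m + 3) (i + (j + 2))) n1.symm (a := x)
    ⟨by rw [edgeSet, finRotate_ofNat]; exact hx,
      by rw [edgeSet, finRotate_ofNat]; exact hx'⟩
  rw [finRotate_ofNat, finRotate_ofNat] at h
  simp only [Set.mem_inter_iff, Set.mem_insert_iff, Set.mem_singleton_iff] at h
  obtain ⟨rfl | rfl, h | h⟩ := h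
  · exact n1 (hinj h).symm
  · exact n2 (hinj h).symm
  · exact n3 (hinj h).symm
  · exact n4 (hinj h).symm

theorem IsSimple.vertexAngleSum_eq (hP : P.IsSimple)
    (hgp : ∀ i j k : Fin (m + 3), i ≠ j → i ≠ k → j ≠ k → orient (P i) (P j) (P k) ≠ 0) (i : ℕ) :
    vertexAngleSum m P.complexVertex i = vertexAngleSum m P.complexVertex 0 := by
  induction i with
  | zero => rfl
  | succ i ih =>
    rw [← ih]
    refine (vertexAngleSum_succ complexVertex_periodic ?_ ?_ ?_).symm
    · exact Plane.im_div_toComplex_ne_zero (hgp _ _ _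
        (Fin.ofNat_add_ne (a := 0) (b := 1) (by lia) (by lia) (by lia))
        (Fin.ofNat_add_ne (a := 0) (b := 2) (by lia) (by lia) (by lia))
        (Fin.ofNat_add_ne (by lia) (by lia) (by lia)))
    · exact Plane.im_div_toComplex_ne_zero (hgp _ _ _
        (Fin.ofNat_add_ne (a := 0) (b := 1) (by lia) (by lia) (by lia))
        (Fin.ofNat_add_ne (a := 0) (b := m + 2) (by lia) (by lia) (by lia))
        (Fin.ofNat_add_ne (b := m + 2) (by lia) (by lia) (by lia)))
    · intro j hj z hz hz'
      obtain ⟨x, hx, rfl⟩ := Plane.exists_of_mem_segment_toComplex hz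
      obtain ⟨y, hy, hxy⟩ := Plane.exists_of_mem_segment_toComplex hz'
      obtain rfl := Plane.toComplex_injective hxy
      exact hP.disjoint_edges i hj hx hy

theorem IsSimple.vertexAngleSum_of_extreme (hP : P.IsSimple)
    (hgp : ∀ i j k : Fin (m + 3), i ≠ j → i ≠ k → j ≠ k → orient (P i) (P j) (P k) ≠ 0)
    {i : Fin (m + 3)} (hi : P i ∉ convexHull ℝ (Set.range P.vertices \ {P i})) :
    vertexAngleSum m P.complexVertex 0 = if 0 < orient (P ((finRotate (m + 3)).symm i)) (P i)
      (P (finRotate (m + 3) i)) then 2 * Real.pi else 0 := by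
  obtain ⟨d, hd⟩ := exists_halfPlane_of_notMem_convexHull
    ((Set.finite_range P.vertices).subset Set.sdiff_subset) hi
  obtain ⟨k, rfl⟩ : ∃ k : ℕ, Fin.ofNat (m + 3) k = i := ⟨i, by ext; simp⟩
  rw [finRotate_ofNat, finRotate_symm_ofNat]
  have n1 := Fin.ofNat_add_ne (n := m + 3) (i := k) (a := 0) (b := 1) (by lia) (by lia) (by lia)
  have n2 := Fin.ofNat_add_ne (n := m + 3) (i := k) (a := 0) (b := m + 2) (by lia) (by lia)
    (by lia)
  have n3 := Fin.ofNat_add_ne (n := m + 3) (i := k) (a := 1) (b := m + 2) (by lia) (by lia)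
    (by lia)
  rw [← hP.vertexAngleSum_eq hgp k, _root_.vertexAngleSum_of_extreme d]
  · refine if_congr ?_ rfl rfl
    rw [← orient_rotate]
    exact Plane.im_div_toComplex_pos_iff fun h => n1 (hP.2.1 h)
  · intro j hj hj'
    refine hd _ ⟨Set.mem_range_self _, fun h => ?_⟩
    exact Fin.ofNat_add_ne (n := m + 3) (i := k) (a := j) (b := 0) (by lia) (by lia) (by lia)
      (hP.2.1 h)
  · exact Plane.im_div_toComplex_ne_zero (hgp _ _ _ n1 n2 n3)

/-- All extreme vertices of a simple polygon turn in the same direction. -/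
theorem IsSimple.orient_pos_iff_of_extreme (hP : P.IsSimple)
    (hgp : ∀ i j k : Fin (m + 3), i ≠ j → i ≠ k → j ≠ k → orient (P i) (P j) (P k) ≠ 0)
    {i j : Fin (m + 3)} (hi : P i ∉ convexHull ℝ (Set.range P.vertices \ {P i}))
    (hj : P j ∉ convexHull ℝ (Set.range P.vertices \ {P j})) :
    0 < orient (P ((finRotate (m + 3)).symm i)) (P i) (P (finRotate (m + 3) i)) ↔
      0 < orient (P ((finRotate (m + 3)).symm j)) (P j) (P (finRotate (m + 3) j)) := by
  have h1 := hP.vertexAngleSum_of_extreme hgp hi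
  have h2 := hP.vertexAngleSum_of_extreme hgp hj
  rw [h1] at h2
  have := Real.pi_pos
  split_ifs at h2 with h3 h4 h4
  · exact ⟨fun _ => h4, fun _ => h3⟩
  · linarith
  · linarith
  · exact ⟨fun h => absurd h h3, fun h => absurd h h4⟩

end Polygon

/-! ### Small pseudo-triangles have triangular hulls. -/

/-- The hull of a pseudo-triangle with at most six vertices is a triangle. -/
theorem ContainsPseudoTriangle.exists_triangle {S : Finset Plane} (hS : InGeneralPosition S)
    {m : ℕ} (hm : m ≤ 3) (h : ContainsPseudoTriangle (m + 3) S) :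
    ∃ a ∈ S, ∃ b ∈ S, ∃ c ∈ S, a ≠ b ∧ a ≠ c ∧ b ≠ c ∧ m ≤ (insideTriangle S a b c).card := by
  classical
  obtain ⟨P, ⟨hP, -, hcx⟩, hPS⟩ := h
  have hinj := hP.2.1
  have hgp : ∀ i j k : Fin (m + 3), i ≠ j → i ≠ k → j ≠ k → orient (P i) (P j) (P k) ≠ 0 :=
    fun i j k hij hik hjk => hS.orient_ne_zero (hPS i) (hPS j) (hPS k)
      (hinj.ne hij) (hinj.ne hik) (hinj.ne hjk)
  set W : Finset Plane := Finset.univ.image P.vertices with hW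
  have hWc : W.card = m + 3 := by
    rw [hW, Finset.card_image_of_injective _ hinj, Finset.card_univ, Fintype.card_fin]
  have hWS : W ⊆ S := by
    intro x hx
    obtain ⟨i, -, rfl⟩ := Finset.mem_image.1 hx
    exact hPS i
  obtain ⟨V, hVW, -, hhull, hext⟩ := exists_convexPosition_hull W
  have hV3 := three_le_card_of_subset_convexHull (hS.mono hWS) (by lia) hhull
  have hWcoe : (W : Set Plane) = Set.range P.vertices := by simp [hW]
  rw [hWcoe] at hext
  set C : Finset (Fin (m + 3)) := Finset.univ.filter fun i => P.interiorAngle i < Real.pi with hC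
  have hCc : C.card = 3 := by
    refine Eq.trans ?_ hcx
    rw [← Set.ncard_coe_finset]; simp [hC]
  set E : Finset (Fin (m + 3)) := Finset.univ.filter fun i => P i ∈ V with hE
  have hEc : E.card = V.card := by
    rw [← Finset.card_image_of_injective E hinj]
    congr 1
    ext x
    simp only [hE, Finset.mem_image, Finset.mem_filter, Finset.mem_univ, true_and]
    constructor
    · rintro ⟨i, hi, rfl⟩; exact hi
    · intro hx
      obtain ⟨i, -, rfl⟩ := Finset.mem_image.1 (hVW hx)
      exact ⟨i, hx, rfl⟩
  have hturn : ∀ i, orient (P ((finRotate (m + 3)).symm i)) (P i) (P (finRotate (m + 3) i)) ≠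
      0 := by
    intro i
    obtain ⟨k, rfl⟩ : ∃ k : ℕ, Fin.ofNat (m + 3) k = i := ⟨i, by ext; simp⟩
    rw [Polygon.finRotate_ofNat, Polygon.finRotate_symm_ofNat]
    exact hgp _ _ _ (Fin.ofNat_add_ne (a := m + 2) (b := 0) (by lia) (by lia) (by lia))
      (Fin.ofNat_add_ne (a := m + 2) (by lia) (by lia) (by lia))
      (Fin.ofNat_add_ne (a := 0) (by lia) (by lia) (by lia))
  have hsame : ∀ i ∈ E, ∀ j ∈ E, i ∈ C → j ∈ C := by
    intro i hi j hj hiC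
    simp only [hC, hE, Finset.mem_filter, Finset.mem_univ, true_and] at hi hj hiC ⊢
    rw [P.interiorAngle_lt_pi_iff _ (hturn _)] at hiC ⊢
    exact (hP.orient_pos_iff_of_extreme hgp (hext _ hi) (hext _ hj)).1 hiC
  have hV : V.card = 3 := by
    refine le_antisymm ?_ hV3
    rw [← hEc]
    -- Since hull vertices all turn alike, either all of them are among the three corners, or none
    -- is; then at most `m ≤ 3` vertices remain for the hull. Thus it need not be shown that
    -- positive area makes hull vertices convex.
    by_cases hne : ∃ i ∈ E, i ∈ C
    · obtain ⟨i, hi, hiC⟩ := hne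
      exact (Finset.card_le_card fun j hj => hsame i hi j hj hiC).trans hCc.le
    · push Not at hne
      have hdis : Disjoint E C := Finset.disjoint_left.2 hne
      have := Finset.card_le_univ (E ∪ C)
      rw [Finset.card_union_of_disjoint hdis, Fintype.card_fin, hCc] at this
      lia
  obtain ⟨a, b, c, hab, hac, hbc, rfl⟩ := Finset.card_eq_three.1 hV
  refine ⟨a, hWS (hVW (by simp)), b, hWS (hVW (by simp)), c, hWS (hVW (by simp)), hab, hac, hbc, ?_⟩
  have hsub : W \ {a, b, c} ⊆ insideTriangle S a b c := by
    intro x hx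
    obtain ⟨hx1, hx2⟩ := Finset.mem_sdiff.1 hx
    simp only [Finset.mem_insert, Finset.mem_singleton, not_or] at hx2
    exact mem_insideTriangle.2 ⟨hWS hx1, by simpa using hhull hx1, hx2⟩
  have h1 := Finset.card_le_card hsub
  have h2 := Finset.card_sdiff_add_card_eq_card hVW
  lia

/-! ### The columns on a parabola and their orientations. -/

/-- The abscissa of the point at level `s` of column `i`: the middle level is moved to the right in
column `1` and to the left in the other columns. -/
noncomputable def columnX (δ : ℝ) (q : ℕ × ℕ) : ℝ :=
  q.1 + if q.2 = 1 then (if q.1 = 1 then δ else -δ) else 0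

/-- Points in nearly vertical columns standing on a parabola. -/
noncomputable def columnPoint (δ : ℝ) (q : ℕ × ℕ) : Plane :=
  !₂[columnX δ q, columnX δ q ^ 2 + q.2 / 10]

@[simp] theorem columnPoint_zero (δ : ℝ) (q : ℕ × ℕ) : columnPoint δ q 0 = columnX δ q := rfl

@[simp] theorem columnPoint_one (δ : ℝ) (q : ℕ × ℕ) :
    columnPoint δ q 1 = columnX δ q ^ 2 + q.2 / 10 := rfl

section Column

variable {δ : ℝ} {m : ℕ}

theorem abs_columnX_sub_le (hδ : 0 < δ) (q : ℕ × ℕ) : |columnX δ q - q.1| ≤ δ := by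
  unfold columnX
  split_ifs <;> simp [abs_of_pos hδ, hδ.le]

theorem abs_columnX_sub_columnX_le (hδ : 0 < δ) {q r : ℕ × ℕ} (h : q.1 = r.1) :
    |columnX δ q - columnX δ r| ≤ δ := by
  unfold columnX
  rw [h]
  split_ifs <;> simp [abs_of_pos hδ, hδ.le]

theorem columnX_gap (hδ : 0 < δ) (hδ' : δ ≤ 1 / 10) {q r : ℕ × ℕ} (h : q.1 < r.1) :
    4 / 5 ≤ columnX δ r - columnX δ q := by
  have h1 := abs_le.1 (abs_columnX_sub_le hδ q)
  have h2 := abs_le.1 (abs_columnX_sub_le hδ r)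
  have h3 : (q.1 : ℝ) + 1 ≤ r.1 := by exact_mod_cast h
  linarith

theorem abs_columnX_le (hδ : 0 < δ) (hδ' : δ ≤ 1 / 10) {q : ℕ × ℕ} (h : q.1 ≤ m) :
    |columnX δ q| ≤ m + 1 := by
  have h1 := abs_le.1 (abs_columnX_sub_le hδ q)
  have h2 : (q.1 : ℝ) ≤ m := by exact_mod_cast h
  have h3 : (0 : ℝ) ≤ q.1 := by positivity
  exact abs_le.2 ⟨by linarith, by linarith⟩

/-- Points of three columns, from left to right, turn left. -/
theorem orient_columnPoint_pos (hδ : 0 < δ) (hδ' : δ ≤ 1 / 10) {q r s : ℕ × ℕ} (hr : r.2 ≤ 2)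
    (h1 : q.1 < r.1) (h2 : r.1 < s.1) :
    0 < orient (columnPoint δ q) (columnPoint δ r) (columnPoint δ s) := by
  have g1 := columnX_gap hδ hδ' h1
  have g2 := columnX_gap hδ hδ' h2
  have hr' : (r.2 : ℝ) ≤ 2 := by exact_mod_cast hr
  set u := columnX δ r - columnX δ q with hu
  set v := columnX δ s - columnX δ r with hv
  -- The parabola contributes `u * v * (u + v)` with `u * v ≥ 16/25`, which outweighs the loss of at
  -- most `(u + v) / 5` from the level of the middle point.
  have key : orient (columnPoint δ q) (columnPoint δ r) (columnPoint δ s) =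
      u * v * (u + v) + q.2 / 10 * v - r.2 / 10 * (u + v) + s.2 / 10 * u := by
    simp only [orient_eq, columnPoint_zero, columnPoint_one, hu, hv]; ring
  rw [key]
  have huv : 16 / 25 ≤ u * v := by nlinarith
  have e1 : 0 ≤ (q.2 : ℝ) / 10 * v := by positivity
  have e2 : 0 ≤ (s.2 : ℝ) / 10 * u := by positivity
  have e3 : 0 < (u * v - r.2 / 10) * (u + v) := mul_pos (by linarith) (by linarith)
  linarith

/-- The estimates for two points of one column. -/
theorem column_estimates (hδ : 0 < δ) (hδm : δ * (1000 * (m + 1) ^ 2) ≤ 1) {q r s : ℕ × ℕ}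
    (hr : r.1 ≤ m) (hq : q.1 ≤ m) (hs : s.1 ≤ m) (hq2 : q.2 ≤ 2) (hqr : q.1 = r.1)
    (h : q.2 < r.2) (hs2 : s.2 ≤ 2) :
    9 / 100 ≤ columnPoint δ r 1 - columnPoint δ q 1 ∧
      |(columnX δ r - columnX δ q) * (columnPoint δ s 1 - columnPoint δ q 1)| ≤ 1 / 100 := by
  have hN : (1 : ℝ) ≤ (m + 1 : ℝ) := by
    have : (0 : ℝ) ≤ m := by positivity
    linarith
  have hN2 : (m + 1 : ℝ) ≤ (m + 1 : ℝ) ^ 2 := by nlinarith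
  have hδ' : δ ≤ 1 / 10 := by nlinarith
  have hD := abs_columnX_sub_columnX_le hδ hqr.symm
  have a1 := abs_columnX_le hδ hδ' hq
  have a2 := abs_columnX_le hδ hδ' hr
  have a3 := abs_columnX_le hδ hδ' hs
  have hlev : (q.2 : ℝ) + 1 ≤ r.2 := by exact_mod_cast h
  simp only [columnPoint_one]
  constructor
  -- Consecutive levels differ by 1/10, while within a column the parabola varies by at most 1/500.
  · have h1 : |(columnX δ r - columnX δ q) * (columnX δ r + columnX δ q)| ≤
        δ * (2 * (m + 1)) := by
      rw [abs_mul]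
      refine mul_le_mul hD ((abs_add_le _ _).trans (by linarith)) (abs_nonneg _) hδ.le
    have h2 : δ * (2 * (m + 1)) ≤ 1 / 500 := by nlinarith
    have h3 := (abs_le.1 h1).1
    nlinarith
  · rw [abs_mul]
    have s1 : columnX δ s ^ 2 ≤ (m + 1 : ℝ) ^ 2 := sq_le_sq' (abs_le.1 a3).1 (abs_le.1 a3).2
    have s2 : columnX δ q ^ 2 ≤ (m + 1 : ℝ) ^ 2 := sq_le_sq' (abs_le.1 a1).1 (abs_le.1 a1).2
    have t1 : (s.2 : ℝ) ≤ 2 := by exact_mod_cast hs2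
    have t2 : (q.2 : ℝ) ≤ 2 := by exact_mod_cast hq2
    have t3 : (0 : ℝ) ≤ s.2 := by positivity
    have t4 : (0 : ℝ) ≤ q.2 := by positivity
    have s3 := sq_nonneg (columnX δ s)
    have s4 := sq_nonneg (columnX δ q)
    have hY : |columnX δ s ^ 2 + s.2 / 10 - (columnX δ q ^ 2 + q.2 / 10)| ≤ 2 * (m + 1 : ℝ) ^ 2 :=
      abs_le.2 ⟨by nlinarith, by nlinarith⟩
    calc _ ≤ δ * (2 * (m + 1 : ℝ) ^ 2) := mul_le_mul hD hY (abs_nonneg _) hδ.le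
      _ ≤ 1 / 100 := by linarith

/-- A point to the right of a column lies to the right of the upward lines spanned by it. -/
theorem orient_columnPoint_neg_of_right (hδ : 0 < δ) (hδm : δ * (1000 * (m + 1) ^ 2) ≤ 1)
    {q r s : ℕ × ℕ} (hr : r.1 ≤ m) (hs : s.1 ≤ m) (hr2 : r.2 ≤ 2) (hs2 : s.2 ≤ 2)
    (hqr : q.1 = r.1) (h : q.2 < r.2) (hrs : r.1 < s.1) :
    orient (columnPoint δ q) (columnPoint δ r) (columnPoint δ s) < 0 := by
  have hδ' : δ ≤ 1 / 10 := by
    have : (0 : ℝ) ≤ m := by positivity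
    nlinarith
  obtain ⟨e1, e2⟩ := column_estimates hδ hδm hr (by lia) hs (by lia) hqr h hs2
  have g := columnX_gap hδ hδ' (q := q) (r := s) (by lia)
  have e3 := (abs_le.1 e2).2
  rw [orient_eq]
  simp only [columnPoint_zero]
  have : 9 / 100 * (4 / 5) ≤ (columnPoint δ r 1 - columnPoint δ q 1) *
      (columnX δ s - columnX δ q) := by gcongr
  linarith

/-- A point to the left of a column lies to the left of the upward lines spanned by it. -/
theorem orient_columnPoint_pos_of_left (hδ : 0 < δ) (hδm : δ * (1000 * (m + 1) ^ 2) ≤ 1)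
    {q r s : ℕ × ℕ} (hr : r.1 ≤ m) (hr2 : r.2 ≤ 2) (hs2 : s.2 ≤ 2)
    (hqr : q.1 = r.1) (h : q.2 < r.2) (hrs : s.1 < r.1) :
    0 < orient (columnPoint δ q) (columnPoint δ r) (columnPoint δ s) := by
  have hδ' : δ ≤ 1 / 10 := by
    have : (0 : ℝ) ≤ m := by positivity
    nlinarith
  obtain ⟨e1, e2⟩ := column_estimates hδ hδm hr (by lia) (s := s) (by lia) (by lia) hqr h hs2
  have g := columnX_gap hδ hδ' (q := s) (r := q) (by lia)
  have e3 := (abs_le.1 e2).1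
  rw [orient_eq]
  simp only [columnPoint_zero]
  have : 9 / 100 * (4 / 5) ≤ (columnPoint δ r 1 - columnPoint δ q 1) *
      (columnX δ q - columnX δ s) := by gcongr
  linarith

theorem orient_columnPoint_one_pos (hδ : 0 < δ) :
    0 < orient (columnPoint δ (1, 0)) (columnPoint δ (1, 1)) (columnPoint δ (1, 2)) := by
  simp [orient_eq, columnX]
  linarith

theorem orient_columnPoint_column_neg (hδ : 0 < δ) {i : ℕ} (hi : i ≠ 1) :
    orient (columnPoint δ (i, 0)) (columnPoint δ (i, 1)) (columnPoint δ (i, 2)) < 0 := by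
  simp [orient_eq, columnX, hi]
  linarith

theorem columnPoint_injOn (hδ : 0 < δ) (hδm : δ * (1000 * (m + 1) ^ 2) ≤ 1) {q r : ℕ × ℕ}
    (hq : q.1 < m) (hr : r.1 < m) (hq2 : q.2 ≤ 2) (hr2 : r.2 ≤ 2)
    (h : columnPoint δ q = columnPoint δ r) : q = r := by
  have hδ' : δ ≤ 1 / 10 := by
    have : (0 : ℝ) ≤ m := by positivity
    nlinarith
  have hx : columnX δ q = columnX δ r := congrArg (fun z : Plane => z 0) h
  rcases lt_trichotomy q.1 r.1 with h1 | h1 | h1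
  · linarith [columnX_gap hδ hδ' h1]
  · rcases lt_trichotomy q.2 r.2 with h2 | h2 | h2
    -- The index `(m, 0)` is an auxiliary point to the right of all columns; a degenerate triangle
    -- would have orientation zero.
    · have := orient_columnPoint_neg_of_right hδ hδm (s := (m, 0)) hr.le le_rfl hr2 (by simp) h1 h2
        hr
      simp [h] at this
    · exact Prod.ext h1 h2
    · have := orient_columnPoint_neg_of_right hδ hδm (s := (m, 0)) hq.le le_rfl hq2 (by simp)
        h1.symm h2 hq
      simp [h] at this
  · linarith [columnX_gap hδ hδ' h1]

end Column

/-! ### The grid: general position and points inside its triangles. -/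

/-- The point at level `q.2` of column `q.1` in the configuration with `m` columns. -/
noncomputable def gridPoint (m : ℕ) (q : ℕ × ℕ) : Plane :=
  columnPoint (1 / (1000 * (m + 1) ^ 2)) q

/-- Columns `0, …, m - 1` with the bottom level everywhere and the levels in `E` except in the two
outer columns. -/
def gridIndices (m : ℕ) (E : Finset ℕ) : Finset (ℕ × ℕ) :=
  (Finset.range m ×ˢ {0}) ∪ (Finset.Ioo 0 (m - 1) ×ˢ E)

/-- The point configuration attaining the lower bounds. -/
noncomputable def gridSet (m : ℕ) (E : Finset ℕ) : Finset Plane := by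
  classical
  exact (gridIndices m E).image (gridPoint m)

section Grid

variable {m : ℕ} {E : Finset ℕ}

theorem mem_gridIndices {q : ℕ × ℕ} :
    q ∈ gridIndices m E ↔ (q.1 < m ∧ q.2 = 0) ∨ (0 < q.1 ∧ q.1 < m - 1 ∧ q.2 ∈ E) := by
  simp only [gridIndices, Finset.mem_union, Finset.mem_product, Finset.mem_range,
    Finset.mem_singleton, Finset.mem_Ioo, and_assoc]

theorem card_gridIndices (hE : E ⊆ {1, 2}) :
    (gridIndices m E).card = m + (m - 2) * E.card := by
  rw [gridIndices, Finset.card_union_of_disjoint, Finset.card_product, Finset.card_product]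
  · simp [Nat.sub_sub]
  · rw [Finset.disjoint_left]
    rintro ⟨i, s⟩ h1 h2
    simp only [Finset.mem_product, Finset.mem_singleton] at h1 h2
    have := hE h2.2
    simp [h1.2] at this

theorem gridIndices_lt {q : ℕ × ℕ} (hq : q ∈ gridIndices m E) : q.1 < m := by
  rcases mem_gridIndices.1 hq with h | h <;> lia

theorem gridIndices_le_two (hE : E ⊆ {1, 2}) {q : ℕ × ℕ} (hq : q ∈ gridIndices m E) :
    q.2 ≤ 2 := by
  rcases mem_gridIndices.1 hq with h | h
  · lia
  · have := hE h.2.2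
    simp only [Finset.mem_insert, Finset.mem_singleton] at this
    lia

theorem grid_delta_pos : (0 : ℝ) < 1 / (1000 * ((m : ℝ) + 1) ^ 2) := by positivity

theorem grid_delta_mul_le :
    1 / (1000 * ((m : ℝ) + 1) ^ 2) * (1000 * ((m : ℝ) + 1) ^ 2) ≤ 1 := by
  rw [one_div, inv_mul_cancel₀ (by positivity)]

theorem grid_delta_le : 1 / (1000 * ((m : ℝ) + 1) ^ 2) ≤ 1 / 10 := by
  have : (0 : ℝ) ≤ m := by positivity
  gcongr
  nlinarith

theorem orient_gridPoint_pos (hE : E ⊆ {1, 2}) {q r s : ℕ × ℕ} (hr : r ∈ gridIndices m E)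
    (h1 : q.1 < r.1) (h2 : r.1 < s.1) :
    0 < orient (gridPoint m q) (gridPoint m r) (gridPoint m s) :=
  orient_columnPoint_pos grid_delta_pos grid_delta_le (gridIndices_le_two hE hr) h1 h2

theorem orient_gridPoint_neg_of_right (hE : E ⊆ {1, 2}) {q r s : ℕ × ℕ}
    (hr : r ∈ gridIndices m E) (hs : s ∈ gridIndices m E) (hqr : q.1 = r.1) (h : q.2 < r.2)
    (hrs : r.1 < s.1) : orient (gridPoint m q) (gridPoint m r) (gridPoint m s) < 0 :=
  orient_columnPoint_neg_of_right grid_delta_pos grid_delta_mul_le (gridIndices_lt hr).le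
    (gridIndices_lt hs).le (gridIndices_le_two hE hr) (gridIndices_le_two hE hs) hqr h hrs

theorem orient_gridPoint_pos_of_left (hE : E ⊆ {1, 2}) {q r s : ℕ × ℕ}
    (hr : r ∈ gridIndices m E) (hs : s ∈ gridIndices m E) (hqr : q.1 = r.1) (h : q.2 < r.2)
    (hrs : s.1 < r.1) : 0 < orient (gridPoint m q) (gridPoint m r) (gridPoint m s) :=
  orient_columnPoint_pos_of_left grid_delta_pos grid_delta_mul_le (gridIndices_lt hr).le
    (gridIndices_le_two hE hr) (gridIndices_le_two hE hs) hqr h hrs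

theorem gridPoint_injOn (hE : E ⊆ {1, 2}) :
    Set.InjOn (gridPoint m) (gridIndices m E : Set (ℕ × ℕ)) := fun _ hq _ hr h =>
  columnPoint_injOn grid_delta_pos grid_delta_mul_le (gridIndices_lt hq) (gridIndices_lt hr)
    (gridIndices_le_two hE hq) (gridIndices_le_two hE hr) h

theorem card_gridSet (hE : E ⊆ {1, 2}) : (gridSet m E).card = m + (m - 2) * E.card := by
  classical
  rw [gridSet, Finset.card_image_of_injOn (gridPoint_injOn hE), card_gridIndices hE]

theorem mem_gridSet {x : Plane} :
    x ∈ gridSet m E ↔ ∃ q ∈ gridIndices m E, gridPoint m q = x := by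
  simp [gridSet]

/-- Order the points by column and then by level. Three points of one column are at levels 0, 1, 2
and the displacement of the middle one prevents collinearity. -/
theorem gridSet_inGeneralPosition (hE : E ⊆ {1, 2}) : InGeneralPosition (gridSet m E) := by
  have sorted : ∀ q ∈ gridIndices m E, ∀ r ∈ gridIndices m E, ∀ s ∈ gridIndices m E,
      (q.1 < r.1 ∨ q.1 = r.1 ∧ q.2 < r.2) → (r.1 < s.1 ∨ r.1 = s.1 ∧ r.2 < s.2) →
      orient (gridPoint m q) (gridPoint m r) (gridPoint m s) ≠ 0 := by
    rintro q hq r hr s hs (h1 | ⟨h1, h1'⟩) (h2 | ⟨h2, h2'⟩)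
    · exact (orient_gridPoint_pos hE hr h1 h2).ne'
    · rw [← orient_rotate]
      exact (orient_gridPoint_pos_of_left hE hs hq h2 h2' (by lia)).ne'
    · exact (orient_gridPoint_neg_of_right hE hr hs h1 h1' h2).ne
    · have := gridIndices_le_two hE hs
      obtain ⟨i, a⟩ := q
      obtain ⟨j, b⟩ := r
      obtain ⟨k, c⟩ := s
      simp only at h1 h1' h2 h2' this
      obtain rfl : a = 0 := by lia
      obtain rfl : b = 1 := by lia
      obtain rfl : c = 2 := by lia
      subst h1 h2
      by_cases hi : i = 1
      · subst hi; exact (orient_columnPoint_one_pos grid_delta_pos).ne'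
      · exact (orient_columnPoint_column_neg grid_delta_pos hi).ne
  have total : ∀ q r : ℕ × ℕ, gridPoint m q ≠ gridPoint m r →
      (q.1 < r.1 ∨ q.1 = r.1 ∧ q.2 < r.2) ∨ (r.1 < q.1 ∨ r.1 = q.1 ∧ r.2 < q.2) := by
    intro q r hne
    have : ¬ (q.1 = r.1 ∧ q.2 = r.2) := fun h => hne (congrArg _ (Prod.ext h.1 h.2))
    lia
  intro a ha b hb c hc hab hac hbc
  obtain ⟨q, hq, rfl⟩ := mem_gridSet.1 ha
  obtain ⟨r, hr, rfl⟩ := mem_gridSet.1 hb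
  obtain ⟨s, hs, rfl⟩ := mem_gridSet.1 hc
  rw [collinear_iff_orient_eq_zero]
  change orient _ _ _ ≠ 0
  rcases total q r hab with h1 | h1 <;> rcases total q s hac with h2 | h2 <;>
    rcases total r s hbc with h3 | h3
  · exact sorted q hq r hr s hs h1 h3
  · rw [← neg_ne_zero, ← orient_swap]; exact sorted q hq s hs r hr h2 h3
  · exfalso; lia
  · rw [← orient_rotate, ← orient_rotate]; exact sorted s hs q hq r hr h2 h1
  · rw [← neg_ne_zero, ← orient_swap_left]; exact sorted r hr q hq s hs h1 h2
  · exfalso; lia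
  · rw [← orient_rotate]; exact sorted r hr s hs q hq h3 h2
  · rw [← neg_ne_zero, ← orient_swap, ← orient_rotate]
    exact sorted s hs r hr q hq h3 h1

/-- A point of the configuration inside a triangle belongs to the column of the middle vertex. -/
theorem column_eq_of_mem_triangle (hE : E ⊆ {1, 2}) {a b c x : ℕ × ℕ} (ha : a ∈ gridIndices m E)
    (hc : c ∈ gridIndices m E)
    (hx : x ∈ gridIndices m E) (hab : a.1 ≤ b.1) (hbc : b.1 ≤ c.1) (hxa : x ≠ a) (hxc : x ≠ c)
    (h : gridPoint m x ∈ convexHull ℝ {gridPoint m a, gridPoint m b, gridPoint m c})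
    (hb : b ∈ gridIndices m E) : x.1 = b.1 := by
  have gap : ∀ {q r : ℕ × ℕ}, q.1 < r.1 → gridPoint m q 0 < gridPoint m r 0 := by
    intro q r hqr
    have := columnX_gap (grid_delta_pos (m := m)) grid_delta_le hqr
    change columnX _ q < columnX _ r
    linarith
  -- If `x` lies in a column before that of `b`, it is either left of the whole triangle or on a
  -- line through `a` with `b` and `c` strictly on one side, which forces `x = a`. Columns after
  -- that of `b` are treated with `c`.
  rcases lt_trichotomy x.1 b.1 with hlt | heq | hgt
  · exfalso
    apply hxa
    apply gridPoint_injOn hE hx ha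
    rcases lt_trichotomy a.1 x.1 with h1 | h1 | h1
    · exact eq_vertex_of_mem_convexHull_triple (p := gridPoint m a) (q := gridPoint m x) h
        (by simp) (by simp) (orient_gridPoint_pos hE hx h1 hlt)
        (orient_gridPoint_pos hE hx h1 (by lia))
    · have hne : a.2 ≠ x.2 := fun h2 => hxa (Prod.ext h1.symm h2.symm)
      rcases hne.lt_or_gt with h2 | h2
      · refine eq_vertex_of_mem_convexHull_triple (p := gridPoint m x) (q := gridPoint m a) h
          (by simp) (by simp) ?_ ?_
        · rw [orient_swap_left, neg_pos]
          exact orient_gridPoint_neg_of_right hE hx hb h1 h2 hlt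
        · rw [orient_swap_left, neg_pos]
          exact orient_gridPoint_neg_of_right hE hx hc h1 h2 (by lia)
      · refine eq_vertex_of_mem_convexHull_triple (p := gridPoint m a) (q := gridPoint m x) h
          (by simp) (by simp) ?_ ?_
        · rw [orient_swap_left, neg_pos]
          exact orient_gridPoint_neg_of_right hE ha hb h1.symm h2 (by lia)
        · rw [orient_swap_left, neg_pos]
          exact orient_gridPoint_neg_of_right hE ha hc h1.symm h2 (by lia)
    · have := affine_pos_of_mem_convexHull h 1 0 (-(gridPoint m x 0)) (by
        simp only [Set.mem_insert_iff, Set.mem_singleton_iff, forall_eq_or_imp, forall_eq]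
        refine ⟨?_, ?_, ?_⟩
        · linarith [gap h1]
        · linarith [gap (q := x) (r := b) (by lia)]
        · linarith [gap (q := x) (r := c) (by lia)])
      linarith
  · exact heq
  · exfalso
    apply hxc
    apply gridPoint_injOn hE hx hc
    rw [Set.pair_comm, Set.insert_comm] at h
    rcases lt_trichotomy x.1 c.1 with h1 | h1 | h1
    · refine eq_vertex_of_mem_convexHull_triple (p := gridPoint m x) (q := gridPoint m c) h
        (by simp) (by simp) ?_ ?_
      · rw [orient_rotate]; exact orient_gridPoint_pos hE hx (by lia) h1
      · rw [orient_rotate]; exact orient_gridPoint_pos hE hx (by lia) h1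
    · have hne : c.2 ≠ x.2 := fun h2 => hxc (Prod.ext h1 h2.symm)
      rcases hne.lt_or_gt with h2 | h2
      · exact eq_vertex_of_mem_convexHull_triple (p := gridPoint m c) (q := gridPoint m x) h
          (by simp) (by simp) (orient_gridPoint_pos_of_left hE hx ha h1.symm h2 (by lia))
          (orient_gridPoint_pos_of_left hE hx hb h1.symm h2 (by lia))
      · exact eq_vertex_of_mem_convexHull_triple (p := gridPoint m x) (q := gridPoint m c) h
          (by simp) (by simp) (orient_gridPoint_pos_of_left hE hc ha h1 h2 (by lia))
          (orient_gridPoint_pos_of_left hE hc hb h1 h2 (by lia))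
    · have := affine_pos_of_mem_convexHull h (-1) 0 (gridPoint m x 0) (by
        simp only [Set.mem_insert_iff, Set.mem_singleton_iff, forall_eq_or_imp, forall_eq]
        refine ⟨?_, ?_, ?_⟩
        · linarith [gap h1]
        · linarith [gap (q := a) (r := x) (by lia)]
        · linarith [gap (q := b) (r := x) (by lia)])
      linarith

theorem insideTriangle_swap_left (S : Finset Plane) (a b c : Plane) :
    insideTriangle S b a c = insideTriangle S a b c := by
  ext x
  simp only [mem_insideTriangle, Set.insert_comm b a]
  tauto

theorem insideTriangle_swap_right (S : Finset Plane) (a b c : Plane) :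
    insideTriangle S a c b = insideTriangle S a b c := by
  ext x
  simp only [mem_insideTriangle, Set.pair_comm c b]
  tauto

/-- The column of the middle vertex has at most `E.card + 1` points, one of which is that vertex. -/
theorem card_insideTriangle_gridSet_le (hE : E ⊆ {1, 2}) {a b c : Plane} (ha : a ∈ gridSet m E)
    (hb : b ∈ gridSet m E) (hc : c ∈ gridSet m E) :
    (insideTriangle (gridSet m E) a b c).card ≤ E.card := by
  classical
  have sorted : ∀ q ∈ gridIndices m E, ∀ r ∈ gridIndices m E, ∀ s ∈ gridIndices m E,
      q.1 ≤ r.1 → r.1 ≤ s.1 → (insideTriangle (gridSet m E) (gridPoint m q) (gridPoint m r)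
        (gridPoint m s)).card ≤ E.card := by
    intro q hq r hr s hs h1 h2
    have hsub : insideTriangle (gridSet m E) (gridPoint m q) (gridPoint m r) (gridPoint m s) ⊆
        (((insert 0 E).erase r.2).image fun l => gridPoint m (r.1, l)) := by
      intro x hx
      obtain ⟨hx, hx', hxq, hxr, hxs⟩ := mem_insideTriangle.1 hx
      obtain ⟨y, hy, rfl⟩ := mem_gridSet.1 hx
      have hcol := column_eq_of_mem_triangle hE hq hs hy h1 h2 (fun h => hxq (h ▸ rfl))
        (fun h => hxs (h ▸ rfl)) hx' hr
      refine Finset.mem_image.2 ⟨y.2, Finset.mem_erase.2 ⟨fun h => ?_, ?_⟩, by rw [← hcol]⟩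
      · exact hxr (congrArg _ (Prod.ext hcol h))
      · rcases mem_gridIndices.1 hy with h | h <;> simp [h.2]
    refine (Finset.card_le_card hsub).trans (Finset.card_image_le.trans ?_)
    have hmem : r.2 ∈ insert 0 E := by
      rcases mem_gridIndices.1 hr with h | h <;> simp [h.2]
    rw [Finset.card_erase_of_mem hmem]
    have := Finset.card_insert_le 0 E
    lia
  obtain ⟨q, hq, rfl⟩ := mem_gridSet.1 ha
  obtain ⟨r, hr, rfl⟩ := mem_gridSet.1 hb
  obtain ⟨s, hs, rfl⟩ := mem_gridSet.1 hc
  rcases le_total q.1 r.1 with h1 | h1 <;> rcases le_total q.1 s.1 with h2 | h2 <;>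
    rcases le_total r.1 s.1 with h3 | h3
  · exact sorted q hq r hr s hs h1 h3
  · rw [← insideTriangle_swap_right]; exact sorted q hq s hs r hr h2 h3
  · exact sorted q hq r hr s hs h1 h3
  · rw [← insideTriangle_swap_right, ← insideTriangle_swap_left]
    exact sorted s hs q hq r hr h2 h1
  · rw [← insideTriangle_swap_left]; exact sorted r hr q hq s hs h1 h2
  · rw [← insideTriangle_swap_right, ← insideTriangle_swap_left, ← insideTriangle_swap_right]
    exact sorted s hs r hr q hq h3 h1
  · rw [← insideTriangle_swap_left, ← insideTriangle_swap_right]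
    exact sorted r hr s hs q hq h3 h2
  · rw [← insideTriangle_swap_right, ← insideTriangle_swap_left, ← insideTriangle_swap_right]
    exact sorted s hs r hr q hq h3 h1

theorem not_containsPseudoTriangle_gridSet (hE : E ⊆ {1, 2}) :
    ¬ ContainsPseudoTriangle (E.card + 4) (gridSet m E) := by
  intro h
  have hcard : E.card ≤ 2 := Finset.card_le_card hE
  obtain ⟨a, ha, b, hb, c, hc, -, -, -, hle⟩ :=
    h.exists_triangle (gridSet_inGeneralPosition hE) (m := E.card + 1) (by lia)
  have := card_insideTriangle_gridSet_le hE ha hb hc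
  lia

end Grid

/-! ### Convex polygons in the grid. -/

section Grid

variable {m : ℕ} {E : Finset ℕ} {Q : Finset (ℕ × ℕ)}

/-- The indices of a convex polygon in the configuration: no point lies in a triangle spanned by
three others. -/
def IsConvexIndexSet (m : ℕ) (Q : Finset (ℕ × ℕ)) : Prop :=
  ∀ q ∈ Q, ∀ a ∈ Q, ∀ b ∈ Q, ∀ c ∈ Q, q ≠ a → q ≠ b → q ≠ c →
    gridPoint m q ∉ convexHull ℝ {gridPoint m a, gridPoint m b, gridPoint m c}

/-- An inner column contributes at most one vertex. -/
theorem IsConvexIndexSet.eq_of_between (hE : E ⊆ {1, 2}) (hQE : Q ⊆ gridIndices m E)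
    (hQ : IsConvexIndexSet m Q) {a c q r : ℕ × ℕ} (ha : a ∈ Q) (hc : c ∈ Q) (hq : q ∈ Q)
    (hr : r ∈ Q) (haq : a.1 < q.1) (hqr : q.1 = r.1) (hrc : r.1 < c.1) : q = r := by
  have main : ∀ q ∈ Q, ∀ r ∈ Q, a.1 < q.1 → q.1 = r.1 → r.1 < c.1 → ¬ q.2 < r.2 := by
    intro q hq r hr haq hqr hrc h
    -- The upper point `r` is above `q` and, as the parabola is convex and the levels are low, still
    -- below the chord from `a` to `c`.
    refine hQ r hr a ha q hq c hc (by rintro rfl; lia) (by rintro rfl; lia) (by rintro rfl; lia) ?_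
    apply mem_convexHull_of_orient_pos
    · rw [← orient_rotate]
      exact orient_gridPoint_pos_of_left hE (hQE hr) (hQE ha) hqr h (by lia)
    · rw [orient_swap, neg_pos]
      exact orient_gridPoint_neg_of_right hE (hQE hr) (hQE hc) hqr h hrc
    · rw [← orient_rotate]
      exact orient_gridPoint_pos hE (hQE hr) (by lia) hrc
  refine Prod.ext hqr ?_
  have h1 := main q hq r hr haq hqr hrc
  have h2 := main r hr q hq (by lia) hqr.symm (by lia)
  lia

/-- In column 1 the middle point is displaced to the right, into the triangle of its two neighbours
and `c`. -/
theorem IsConvexIndexSet.not_full_column_one (hE : E ⊆ {1, 2}) (hQE : Q ⊆ gridIndices m E)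
    (hQ : IsConvexIndexSet m Q) {c : ℕ × ℕ} (hc : c ∈ Q) (h1c : 1 < c.1) (h0 : (1, 0) ∈ Q)
    (h1 : (1, 1) ∈ Q) (h2 : (1, 2) ∈ Q) : False := by
  refine hQ (1, 1) h1 (1, 0) h0 c hc (1, 2) h2 (by simp) (by rintro rfl; simp at h1c) (by simp) ?_
  apply mem_convexHull_of_orient_pos
  · rw [orient_swap, neg_pos]
    exact orient_gridPoint_neg_of_right hE (hQE h1) (hQE hc) rfl (by simp) h1c
  · rw [orient_swap, neg_pos, ← orient_rotate]
    exact orient_gridPoint_neg_of_right hE (hQE h2) (hQE hc) rfl (by simp) h1c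
  · rw [← orient_rotate]
    exact orient_columnPoint_one_pos grid_delta_pos

/-- Elsewhere the middle point is displaced to the left, towards `a`. -/
theorem IsConvexIndexSet.not_full_column (hE : E ⊆ {1, 2}) (hQE : Q ⊆ gridIndices m E)
    (hQ : IsConvexIndexSet m Q) {a : ℕ × ℕ} {i : ℕ} (ha : a ∈ Q) (hai : a.1 < i) (hi : i ≠ 1)
    (h0 : (i, 0) ∈ Q) (h1 : (i, 1) ∈ Q) (h2 : (i, 2) ∈ Q) : False := by
  refine hQ (i, 1) h1 a ha (i, 0) h0 (i, 2) h2 (by rintro rfl; simp at hai) (by simp) (by simp) ?_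
  apply mem_convexHull_of_orient_pos
  · rw [← orient_rotate]
    exact orient_gridPoint_pos_of_left hE (hQE h1) (hQE ha) rfl (by simp) hai
  · rw [orient_swap, neg_pos]
    exact orient_columnPoint_column_neg grid_delta_pos hi
  · rw [← orient_rotate, ← orient_rotate]
    exact orient_gridPoint_pos_of_left hE (hQE h2) (hQE ha) rfl (by simp) hai

theorem column_subset (hE : E ⊆ {1, 2}) (hQE : Q ⊆ gridIndices m E) (i : ℕ) :
    (Q.filter fun q => q.1 = i) ⊆ {(i, 0), (i, 1), (i, 2)} := by
  rintro ⟨j, s⟩ hq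
  obtain ⟨hq', rfl⟩ := Finset.mem_filter.1 hq
  have := gridIndices_le_two hE (hQE hq')
  simp only at this
  interval_cases s <;> simp

theorem card_column_le_three (hE : E ⊆ {1, 2}) (hQE : Q ⊆ gridIndices m E) (i : ℕ) :
    (Q.filter fun q => q.1 = i).card ≤ 3 :=
  (Finset.card_le_card (column_subset hE hQE i)).trans Finset.card_le_three

theorem card_column_le_two (hE : E ⊆ {1, 2}) (hQE : Q ⊆ gridIndices m E) (i : ℕ)
    (h : ¬ ((i, 0) ∈ Q ∧ (i, 1) ∈ Q ∧ (i, 2) ∈ Q)) : (Q.filter fun q => q.1 = i).card ≤ 2 := by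
  classical
  have hss : (Q.filter fun q => q.1 = i) ⊂ {(i, 0), (i, 1), (i, 2)} := by
    refine (column_subset hE hQE i).ssubset_of_ne fun heq => h ?_
    refine ⟨?_, ?_, ?_⟩
    · exact (Finset.mem_filter.1 (heq ▸ (by simp) : (i, 0) ∈ Q.filter fun q => q.1 = i)).1
    · exact (Finset.mem_filter.1 (heq ▸ (by simp) : (i, 1) ∈ Q.filter fun q => q.1 = i)).1
    · exact (Finset.mem_filter.1 (heq ▸ (by simp) : (i, 2) ∈ Q.filter fun q => q.1 = i)).1
  have := (Finset.card_lt_card hss).trans_le Finset.card_le_three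
  lia

theorem card_outer_column_le_one (hQE : Q ⊆ gridIndices m E) {i : ℕ} (hi : i = 0 ∨ m ≤ i + 1) :
    (Q.filter fun q => q.1 = i).card ≤ 1 := by
  refine Finset.card_le_one.2 fun q hq r hr => ?_
  obtain ⟨hq, hqi⟩ := Finset.mem_filter.1 hq
  obtain ⟨hr, hri⟩ := Finset.mem_filter.1 hr
  have h1 := mem_gridIndices.1 (hQE hq)
  have h2 := mem_gridIndices.1 (hQE hr)
  refine Prod.ext (by lia) ?_
  rcases h1 with h1 | h1
  · rcases h2 with h2 | h2
    · lia
    · exfalso; lia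
  · exfalso; lia

/-- A convex polygon in the configuration has at most as many vertices as there are columns. -/
theorem IsConvexIndexSet.card_le (hE : E ⊆ {1, 2}) (hm : 2 ≤ m) (hmE : 1 ∉ E ∨ 4 ≤ m)
    (hQE : Q ⊆ gridIndices m E) (hQ : IsConvexIndexSet m Q) : Q.card ≤ m := by
  classical
  rcases Q.eq_empty_or_nonempty with rfl | hne
  · simp
  obtain ⟨a, ha, hamin⟩ := Q.exists_min_image Prod.fst hne
  obtain ⟨c, hc, hcmax⟩ := Q.exists_max_image Prod.fst hne
  have hcm := gridIndices_lt (hQE hc)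
  have hac := hamin c hc
  have hfull : 1 ∉ E → ∀ i, (Q.filter fun q => q.1 = i).card ≤ 2 := by
    intro h1 i
    refine card_column_le_two hE hQE i fun h => h1 ?_
    rcases mem_gridIndices.1 (hQE h.2.1) with h | h
    · simp at h
    · exact h.2.2
  have hsum : Q.card = ∑ i ∈ Finset.Icc a.1 c.1, (Q.filter fun q => q.1 = i).card :=
    Finset.card_eq_sum_card_fiberwise fun q hq => by
      simpa using ⟨hamin q hq, hcmax q hq⟩
  rcases hac.eq_or_lt with heq | hlt
  · rw [heq, Finset.Icc_self, Finset.sum_singleton] at hsum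
    rw [hsum]
    rcases hmE with h | h
    · exact (hfull h _).trans hm
    · exact (card_column_le_three hE hQE _).trans (by lia)
  have hsplit : ∑ i ∈ Finset.Icc a.1 c.1, (Q.filter fun q => q.1 = i).card =
      (Q.filter fun q => q.1 = a.1).card + (Q.filter fun q => q.1 = c.1).card +
        ∑ i ∈ Finset.Ioo a.1 c.1, (Q.filter fun q => q.1 = i).card := by
    rw [← Finset.Ioc_insert_left hac, Finset.sum_insert (by simp),
      ← Finset.Ioo_insert_right hlt, Finset.sum_insert (by simp)]
    ring
  have hmid : ∑ i ∈ Finset.Ioo a.1 c.1, (Q.filter fun q => q.1 = i).card ≤ c.1 - a.1 - 1 := by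
    refine (Finset.sum_le_card_nsmul _ _ 1 fun i hi => ?_).trans (by simp)
    obtain ⟨hi1, hi2⟩ := Finset.mem_Ioo.1 hi
    refine Finset.card_le_one.2 fun q hq r hr => ?_
    obtain ⟨hq, hqi⟩ := Finset.mem_filter.1 hq
    obtain ⟨hr, hri⟩ := Finset.mem_filter.1 hr
    exact hQ.eq_of_between hE hQE ha hc hq hr (by lia) (by lia) (by lia)
  -- This bound, `m - c.1` on the right and `c.1 - a.1 - 1` in between add up to `m`. From column 2
  -- on, even a full column of three points is affordable.
  have hleft : (Q.filter fun q => q.1 = a.1).card ≤ a.1 + 1 := by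
    rcases Nat.lt_or_ge a.1 2 with h | h
    · interval_cases hcol : a.1
      · exact card_outer_column_le_one hQE (Or.inl rfl)
      · exact card_column_le_two hE hQE 1 fun h => hQ.not_full_column_one hE hQE hc hlt h.1 h.2.1
          h.2.2
    · exact (card_column_le_three hE hQE _).trans (by lia)
  -- Column 1 as the last column may be full, since it bends away from column 0. The polygon then
  -- has at most 1 + 3 vertices, whence the need for four columns.
  by_cases hc1 : c.1 = 1 ∧ 4 ≤ m
  · have := card_column_le_three hE hQE c.1
    lia
  have hright : (Q.filter fun q => q.1 = c.1).card ≤ m - c.1 := by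
    rcases Nat.lt_or_ge (c.1 + 1) m with h | h
    · refine le_trans ?_ (show 2 ≤ m - c.1 by lia)
      by_cases h1 : 1 ∈ E
      · have hc1' : c.1 ≠ 1 := fun h2 => hc1 ⟨h2, hmE.resolve_left (not_not.2 h1)⟩
        exact card_column_le_two hE hQE _ fun h =>
          hQ.not_full_column hE hQE ha hlt hc1' h.1 h.2.1 h.2.2
      · exact hfull h1 _
    · exact (card_outer_column_le_one hQE (Or.inr h)).trans (by lia)
  lia

theorem not_containsConvexGon_gridSet (hE : E ⊆ {1, 2}) (hm : 2 ≤ m) (hmE : 1 ∉ E ∨ 4 ≤ m)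
    {k : ℕ} (hk : m < k) : ¬ ContainsConvexGon k (gridSet m E) := by
  classical
  rintro ⟨T, hTS, hTk, hT⟩
  have hT' := convexIndependent_set_iff_notMem_convexHull_sdiff (s := (T : Set Plane)).1 hT
  set Q := (gridIndices m E).filter fun q => gridPoint m q ∈ T with hQ
  have hQE : Q ⊆ gridIndices m E := Finset.filter_subset _ _
  have hinj : Set.InjOn (gridPoint m) (Q : Set (ℕ × ℕ)) :=
    (gridPoint_injOn hE).mono (by exact_mod_cast hQE)
  have himg : Q.image (gridPoint m) = T := by
    ext x
    simp only [hQ, Finset.mem_image, Finset.mem_filter]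
    constructor
    · rintro ⟨q, ⟨-, h⟩, rfl⟩; exact h
    · intro hx
      obtain ⟨q, hq, rfl⟩ := mem_gridSet.1 (hTS hx)
      exact ⟨q, ⟨hq, hx⟩, rfl⟩
  have hcard : Q.card = k := by
    rw [← hTk, ← himg, Finset.card_image_of_injOn hinj]
  have hconv : IsConvexIndexSet m Q := by
    intro q hq a ha b hb c hc hqa hqb hqc hmem
    refine hT' _ (Finset.mem_filter.1 hq).2 (convexHull_mono ?_ hmem)
    simp only [Set.insert_subset_iff, Set.singleton_subset_iff]
    exact ⟨⟨(Finset.mem_filter.1 ha).2, fun h => hqa (hinj hq ha h.symm)⟩,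
      ⟨(Finset.mem_filter.1 hb).2, fun h => hqb (hinj hq hb h.symm)⟩,
      ⟨(Finset.mem_filter.1 hc).2, fun h => hqc (hinj hq hc h.symm)⟩⟩
  have := hconv.card_le hE hm hmE hQE
  lia

end Grid

/-! ### The values of `F`. -/

/-- If `S` has no convex `k`-gon, some triangle contains many points of `S`. -/
theorem containsConvexGon_or_exists_triangle {S : Finset Plane} (hS : InGeneralPosition S)
    (hcard : 3 ≤ S.card) {k t : ℕ} (hk : (t + 1) * (k - 1) < S.card + 2 * t) :
    ContainsConvexGon k S ∨ ∃ a ∈ S, ∃ b ∈ S, ∃ c ∈ S, a ≠ b ∧ a ≠ c ∧ b ≠ c ∧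
      t + 1 ≤ (insideTriangle S a b c).card := by
  by_cases h : ∀ a ∈ S, ∀ b ∈ S, ∀ c ∈ S, a ≠ b → a ≠ c → b ≠ c →
      (insideTriangle S a b c).card ≤ t
  · obtain ⟨V, hVS, hV, hle⟩ := exists_large_convexPosition hS hcard h
    refine Or.inl (containsConvexGon_of_convexPosition hVS hV ?_)
    have : k - 1 < V.card := Nat.lt_of_mul_lt_mul_left (hk.trans_le hle)
    lia
  · push Not at h
    exact Or.inr h

/-- Forcing numbers are closed upwards, so failure at `n` excludes everything below. Nonemptiness
rules out the default value 0 of the infimum. -/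
theorem F_eq_succ {k ℓ n : ℕ} (h1 : n + 1 ∈ ForcingNumbers k ℓ) (h2 : n ∉ ForcingNumbers k ℓ) :
    (ForcingNumbers k ℓ).Nonempty ∧ F k ℓ = n + 1 := by
  refine ⟨⟨_, h1⟩, le_antisymm (Nat.sInf_le h1) ?_⟩
  by_contra! h
  have hmem : F k ℓ ∈ ForcingNumbers k ℓ := Nat.sInf_mem ⟨_, h1⟩
  exact h2 fun S hS hn => hmem S hS (le_trans (by lia) hn)

theorem notMem_forcingNumbers_of_gridSet {m k ℓ : ℕ} {E : Finset ℕ} (hE : E ⊆ {1, 2})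
    (hm : 2 ≤ m) (hmE : 1 ∉ E ∨ 4 ≤ m) (hk : m < k)
    (hℓ : ¬ ContainsPseudoTriangle ℓ (gridSet m E)) :
    m + (m - 2) * E.card ∉ ForcingNumbers k ℓ := fun h =>
  (h (gridSet m E) (gridSet_inGeneralPosition hE) (card_gridSet hE).ge).elim
    (not_containsConvexGon_gridSet hE hm hmE hk) hℓ

theorem not_containsPseudoTriangle_of_card_lt {S : Finset Plane} {ℓ : ℕ} (h : S.card < ℓ) :
    ¬ ContainsPseudoTriangle ℓ S := by
  classical
  rintro ⟨P, ⟨hP, -, -⟩, hPS⟩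
  have h1 : (Finset.univ.image P.vertices).card = ℓ := by
    rw [Finset.card_image_of_injective _ hP.2.1, Finset.card_univ, Fintype.card_fin]
  have h2 := Finset.card_le_card (show Finset.univ.image P.vertices ⊆ S by
    intro x hx
    obtain ⟨i, -, rfl⟩ := Finset.mem_image.1 hx
    exact hPS i)
  lia

theorem F_five (k : ℕ) (hk : 3 ≤ k) :
    (ForcingNumbers k 5).Nonempty ∧ F k 5 = 2 * k - 3 := by
  have hcard : k - 1 + (k - 1 - 2) * ({2} : Finset ℕ).card = 2 * k - 4 := by simp; lia
  rw [show 2 * k - 3 = 2 * k - 4 + 1 by lia]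
  refine F_eq_succ ?_ ?_
  · intro S hS hn
    refine (containsConvexGon_or_exists_triangle hS (by lia) (t := 1) (by lia)).imp_right ?_
    rintro ⟨a, ha, b, hb, c, hc, hab, hac, hbc, h⟩
    exact containsPseudoTriangle_five_of_two_inside hS ha hb hc hab hac hbc h
  · rw [← hcard]
    exact notMem_forcingNumbers_of_gridSet (by simp) (by lia) (Or.inl (by simp)) (by lia)
      (not_containsPseudoTriangle_gridSet (E := {2}) (by simp))

theorem forcingNumbers_six {k n : ℕ} (hk : 3 * k - 6 ≤ n) (hn : 3 ≤ n) (hk3 : 3 ≤ k) :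
    n ∈ ForcingNumbers k 6 := by
  intro S hS hSn
  refine (containsConvexGon_or_exists_triangle hS (by lia) (t := 2) (by lia)).imp_right ?_
  rintro ⟨a, ha, b, hb, c, hc, hab, hac, hbc, h⟩
  exact containsPseudoTriangle_six_of_three_inside hS ha hb hc hab hac hbc h

/-- With fewer than four columns only the grid with one extra level is available. It has at most
four points, too few for six vertices. -/
theorem notMem_forcingNumbers_six_of_le_four {k : ℕ} (hk : 3 ≤ k) (hk4 : k ≤ 4) :
    2 * k - 4 ∉ ForcingNumbers k 6 := by
  have hcard : k - 1 + (k - 1 - 2) * ({2} : Finset ℕ).card = 2 * k - 4 := by simp; lia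
  rw [← hcard]
  refine notMem_forcingNumbers_of_gridSet (by simp) (by lia) (Or.inl (by simp)) (by lia)
    (not_containsPseudoTriangle_of_card_lt ?_)
  rw [card_gridSet (by simp), hcard]
  lia

theorem F_six (k : ℕ) (hk : 3 ≤ k) (hk4 : k ≠ 4) :
    (ForcingNumbers k 6).Nonempty ∧ F k 6 = 3 * k - 6 := by
  rw [show 3 * k - 6 = 3 * k - 7 + 1 by lia]
  refine F_eq_succ (forcingNumbers_six (by lia) (by lia) hk) ?_
  rcases hk.eq_or_lt with rfl | hk
  · exact notMem_forcingNumbers_six_of_le_four (k := 3) (by lia) (by lia)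
  · have hcard : k - 1 + (k - 1 - 2) * ({1, 2} : Finset ℕ).card = 3 * k - 7 := by
      rw [show ({1, 2} : Finset ℕ).card = 2 from rfl]; lia
    rw [← hcard]
    exact notMem_forcingNumbers_of_gridSet (by simp) (by lia) (Or.inr (by lia)) (by lia)
      (not_containsPseudoTriangle_gridSet (E := {1, 2}) (by simp))

theorem F_four_six : (ForcingNumbers 4 6).Nonempty ∧ F 4 6 = 5 := by
  refine F_eq_succ (n := 4) ?_ (notMem_forcingNumbers_six_of_le_four (k := 4) (by lia) (by lia))
  intro S hS hn
  left
  -- Already `t = 1` suffices, as 2 · 3 < 5 + 2, and both alternatives end in a convex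
  -- quadrilateral.
  rcases containsConvexGon_or_exists_triangle hS (k := 4) (by lia) (t := 1) (by lia) with h | h
  · exact h
  · obtain ⟨a, ha, b, hb, c, hc, hab, hac, hbc, h⟩ := h
    exact containsConvexGon_four_of_two_inside hS ha hb hc hab hac hbc h

theorem theorem6 :
    (∀ k : ℕ, 3 ≤ k → (ForcingNumbers k 5).Nonempty ∧ F k 5 = 2 * k - 3) ∧
    (∀ k : ℕ, 3 ≤ k → k ≠ 4 → (ForcingNumbers k 6).Nonempty ∧ F k 6 = 3 * k - 6) ∧
    ((ForcingNumbers 4 6).Nonempty ∧ F 4 6 = 5) :=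
  ⟨F_five, F_six, F_four_six⟩
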